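/- **Setting.** Let $X$ be a $\sigma$-compact locally compact Hausdorff space with Borel $\sigma$-algebra $\Sigma_X$, let $\mathcal C_X$ be the collection of open subsets of $X$ with compact closure, and let $\mathcal B\subset\mathcal B(\mathcal H)$ be a (not necessarily closed) hereditary $*$-subalgebra of the bounded operators on a complex Hilbert space $\mathcal H$, i.e. $0\le b\le a$ and $a\in\mathcal B$ imply $b\in\mathcal B$. Let $B_0(X)$ be the $C^*$-algebra of bounded Borel functions generated by $\{\chi_U:U\in\mathcal C_X\}$ in the sup norm. A *positive operator-valued measure* is a map $A:\Sigma_X\to\mathcal B(\mathcal H)$ with $A(\emptyset)=0$ and $A(\Delta)\ge0$ that is countably additive in the weak operator topology; $T=\int_X f\,dA$ means $\langle Tv,w\rangle=\int_X f(x)\,\langle dA(x)v,w\rangle$ for all $v,w\in\mathcal H$. A *locally $\mathcal B$-valued Borel asymptotic spectral measure* (ASM) is a family $\{A_\hbar\}_{\hbar\in(0,1]}$ of positive operator-valued measures on $\Sigma_X$ such that $\limsup_{\hbar\to0}\|A_\hbar(X)\|\le1$ and, for all $U,V\in\mathcal C_X$: $A_\hbar(U)\in\mathcal B$; $\hbar\mapsto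 A_\hbar(U)$ is norm continuous on $(0,1]$; and $\|A_\hbar(U\cap V)-A_\hbar(U)A_\hbar(V)\|\to0$ as $\hbar\to0$. Two ASMs are *equivalent* if $\|A_\hbar(U)-A'_\hbar(U)\|\to0$ for all $U\in\mathcal C_X$; the set of classes is $(\!(X,\mathcal B)\!)$. A *(completely) positive asymptotic morphism* between $C^*$-algebras $\mathcal A\to\mathcal D$ is a family $\{Q_\hbar\}_{\hbar\in(0,1]}$ of (completely) positive linear maps such that, for all $f,g\in\mathcal A$, $\hbar\mapsto Q_\hbar(f)$ is continuous and $\|Q_\hbar(fg)-Q_\hbar(f)Q_\hbar(g)\|\to0$ as $\hbar\to0$. Two of them are *equivalent* if $\|Q_\hbar(f)-Q'_\hbar(f)\|\to0$ for all $f\in\mathcal A$; $[\![\mathcal A,\mathcal D]\!]_{acp}$ is the set of classes of completely positive ones. **Corollary 4.3.** $C_0(X)\subset B_0(X)$, and the following hold. 1. For every locally $\mathcal B$-valued Borel ASM $\{A_\hbar\}$ there is a positive asymptotic morphism $\{Q_\hbar\}:B_0(X)\to\mathcal B(\mathcal H)$, mapping $C_0(X)$ into $\overline{\mathcal B}$ and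 $C_c(X)$ into $\mathcal B$, such that $$Q_\hbar(f)=\int_X f\,dA_\hbar\qquad(f\in B_0(X))\tag{$*$}$$ for all sufficiently small $\hbar$; if $\sup_{\hbar\in(0,1]}\|A_\hbar(X)\|<\infty$ (for instance if every $A_\hbar$ is normalized, or if $X$ is compact), then $\{Q_\hbar\}$ can be chosen so that $(*)$ holds for all $\hbar\in(0,1]$. 2. If $\{A_\hbar\},\{A'_\hbar\}$ are locally $\mathcal B$-valued Borel ASMs and $\{Q_\hbar\},\{Q'_\hbar\}:B_0(X)\to\mathcal B(\mathcal H)$ are positive asymptotic morphisms related to them by $(*)$ for all sufficiently small $\hbar$, then $\{A_\hbar\}$ and $\{A'_\hbar\}$ are equivalent if and only if $\{Q_\hbar\}$ and $\{Q'_\hbar\}$ are equivalent. 3. For every locally $\mathcal B$-valued Borel ASM $\{A_\hbar\}$ there is a completely positive asymptotic morphism $\{R_\hbar\}:C_0(X)\to\overline{\mathcal B}$ with $R_\hbar(f)=\int_X f\,dA_\hbar$ for all $f\in C_0(X)$, for all sufficiently small $\hbar$, and for all $\hbar\in(0,1]$ if $\sup_\hbar\|A_\hbar(X)\|<\infty$.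 There is exactly one map $$(\!(X,\mathcal B)\!)\to[\![C_0(X),\overline{\mathcal B}]\!]_{acp}$$ that sends the class of $\{A_\hbar\}$ to the class of $\{R_\hbar\}$, for every ASM $\{A_\hbar\}$ and every such $\{R_\hbar\}$ (related to $\{A_\hbar\}$ for all sufficiently small $\hbar$). -/

import Mathlib

open Filter Topology MeasureTheory
open scoped InnerProductSpace ENNReal ZeroAtInfty CStarAlgebra

noncomputable section

namespace AsymSpec

/-! ### The parameter space -/

/-- The parameter space `(0,1]` of Planck's constant. -/
abbrev Planck : Type := Set.Ioc (0 : ℝ) 1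

/-- The filter `ħ → 0` on `(0,1]`. -/
def toZero : Filter Planck := comap ((↑) : Planck → ℝ) (𝓝 0)

/-! ### Orders on the C*-algebras involved

Mathlib's maps `→ₚ` (positive) and `→CP` (completely positive) refer to orders on the source and
the target.  All orders below are the usual C*-algebra order, whose positive elements are the
elements `b* b`. -/

section Orders

instance zeroAtInftyPartialOrder {X : Type*} [TopologicalSpace X] : PartialOrder C₀(X, ℂ) :=
  CStarAlgebra.spectralOrder _

instance zeroAtInftyStarOrderedRing {X : Type*} [TopologicalSpace X] :
    StarOrderedRing C₀(X, ℂ) :=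
  CStarAlgebra.spectralOrderedRing _

/-- The order on the C*-algebra `ℓ^∞(X)` of all bounded complex functions on `X`. -/
instance bddFunPartialOrder {X : Type*} : PartialOrder (lp (fun _ : X => ℂ) ∞) :=
  CStarAlgebra.spectralOrder _

instance bddFunStarOrderedRing {X : Type*} : StarOrderedRing (lp (fun _ : X => ℂ) ∞) :=
  CStarAlgebra.spectralOrderedRing _

variable {A : Type*} [NonUnitalCStarAlgebra A]

instance isClosed_topologicalClosure (S : NonUnitalStarSubalgebra ℂ A) :
    IsClosed (S.topologicalClosure : Set A) :=
  S.isClosed_topologicalClosure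

/-- In a closed `*`-subalgebra the inherited order is the C*-algebra order of the subalgebra. -/
instance closedSubalgebraStarOrderedRing [PartialOrder A] [StarOrderedRing A]
    (S : NonUnitalStarSubalgebra ℂ A) [hS : IsClosed (S : Set A)] : StarOrderedRing S :=
  StarOrderedRing.of_le_iff fun x y => by
    constructor
    · intro h
      have h0 : 0 ≤ (y : A) - x := sub_nonneg.2 h
      have hmem : CFC.sqrt ((y : A) - x) ∈ S := by
        rw [CFC.sqrt_eq_real_sqrt _ h0]
        exact cfcₙ_mem (𝕜 := ℝ) (s := S) Real.sqrt (y - x).2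
      refine ⟨⟨_, hmem⟩, Subtype.ext ?_⟩
      have hsa : star (CFC.sqrt ((y : A) - x)) = CFC.sqrt ((y : A) - x) :=
        (CFC.sqrt_nonneg _).isSelfAdjoint
      change (y : A) = x + star (CFC.sqrt ((y : A) - x)) * CFC.sqrt ((y : A) - x)
      rw [hsa, CFC.sqrt_mul_sqrt_self _ h0]
      abel
    · rintro ⟨s, rfl⟩
      change (x : A) ≤ x + star (s : A) * s
      exact le_add_of_nonneg_right (star_mul_self_nonneg _)

end Orders

/-! ### Asymptotic morphisms -/

section AsymptoticMorphisms

variable (A B : Type*) [NonUnitalCStarAlgebra A] [PartialOrder A] [StarOrderedRing A]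
  [NonUnitalCStarAlgebra B] [PartialOrder B] [StarOrderedRing B]

/-- A positive asymptotic morphism `{Q_ħ} : A → B`. -/
structure PosAsymptoticMorphism where
  toMap : Planck → (A →ₚ[ℂ] B)
  continuous_apply : ∀ f : A, Continuous fun ħ => toMap ħ f
  asymp_mul : ∀ f g : A,
    Tendsto (fun ħ => ‖toMap ħ (f * g) - toMap ħ f * toMap ħ g‖) toZero (𝓝 0)

/-- A completely positive asymptotic morphism `{Q_ħ} : A → B`. -/
structure CPAsymptoticMorphism where
  toMap : Planck → (A →CP B)
  continuous_apply : ∀ f : A, Continuous fun ħ => toMap ħ f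
  asymp_mul : ∀ f g : A,
    Tendsto (fun ħ => ‖toMap ħ (f * g) - toMap ħ f * toMap ħ g‖) toZero (𝓝 0)

variable {A B}

/-- Equivalence of positive asymptotic morphisms. -/
def PosAsymptoticMorphism.Equivalent (Q R : PosAsymptoticMorphism A B) : Prop :=
  ∀ f : A, Tendsto (fun ħ => ‖Q.toMap ħ f - R.toMap ħ f‖) toZero (𝓝 0)

/-- Equivalence of completely positive asymptotic morphisms. -/
def CPAsymptoticMorphism.Equivalent (Q R : CPAsymptoticMorphism A B) : Prop :=
  ∀ f : A, Tendsto (fun ħ => ‖Q.toMap ħ f - R.toMap ħ f‖) toZero (𝓝 0)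

theorem tendsto_norm_sub_trans {E : Type*} [SeminormedAddCommGroup E] {u v w : Planck → E}
    (h₁ : Tendsto (fun ħ => ‖u ħ - v ħ‖) toZero (𝓝 0))
    (h₂ : Tendsto (fun ħ => ‖v ħ - w ħ‖) toZero (𝓝 0)) :
    Tendsto (fun ħ => ‖u ħ - w ħ‖) toZero (𝓝 0) :=
  squeeze_zero (fun _ => norm_nonneg _) (fun _ => norm_sub_le_norm_sub_add_norm_sub _ _ _)
    (by simpa using h₁.add h₂)

variable (A B) in
/-- Asymptotic equivalence as a setoid. -/
def CPAsymptoticMorphism.setoid : Setoid (CPAsymptoticMorphism A B) where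
  r := CPAsymptoticMorphism.Equivalent
  iseqv :=
    { refl := fun Q f => by simpa using tendsto_const_nhds
      symm := fun h f => by simpa only [norm_sub_rev] using h f
      trans := fun h₁ h₂ f => tendsto_norm_sub_trans (h₁ f) (h₂ f) }

variable (A B) in
/-- The set `⟦A, B⟧_acp` of equivalence classes of completely positive asymptotic morphisms. -/
def CPClasses : Type _ := Quotient (CPAsymptoticMorphism.setoid A B)

/-- The class `⟦Q_ħ⟧_acp`. -/
def CPAsymptoticMorphism.cls (Q : CPAsymptoticMorphism A B) : CPClasses A B :=
  Quotient.mk (CPAsymptoticMorphism.setoid A B) Q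

end AsymptoticMorphisms

/-! ### Positive operator-valued measures -/

section POVMs

variable (X : Type*) [MeasurableSpace X]
  (H : Type*) [NormedAddCommGroup H] [InnerProductSpace ℂ H] [CompleteSpace H]

/-- A positive operator-valued measure on `X`: positive and countably additive in the weak operator
topology.  It is a function on the `σ`-algebra; as for Mathlib's vector measures, non-measurable
sets are given the value `0`. -/
structure POVM where
  toFun : Set X → H →L[ℂ] H
  empty' : toFun ∅ = 0
  nonneg' : ∀ Δ, MeasurableSet Δ → 0 ≤ toFun Δ
  not_measurable' : ∀ Δ, ¬ MeasurableSet Δ → toFun Δ = 0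
  iUnion' : ∀ Δ : ℕ → Set X, (∀ n, MeasurableSet (Δ n)) →
    Pairwise (Function.onFun Disjoint Δ) →
    ∀ v w : H, HasSum (fun n => ⟪w, toFun (Δ n) v⟫_ℂ) ⟪w, toFun (⋃ n, Δ n) v⟫_ℂ

variable {X H}

instance : CoeFun (POVM X H) (fun _ => Set X → H →L[ℂ] H) := ⟨POVM.toFun⟩

/-- The complex measure `Δ ↦ ⟨A(Δ) v, w⟩` (linear in `v`, conjugate linear in `w`). -/
def POVM.coeff (A : POVM X H) (v w : H) : ComplexMeasure X where
  measureOf' Δ := ⟪w, A Δ v⟫_ℂ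
  empty' := by simp [A.empty']
  not_measurable' Δ hΔ := by simp [A.not_measurable' Δ hΔ]
  m_iUnion' Δ hΔ hd := A.iUnion' Δ hΔ hd v w

/-- `A.IsIntegral f T` says that `T = ∫ f dA` in the weak sense:
`⟨T v, w⟩ = ∫ f(x) ⟨dA(x) v, w⟩` for all `v, w`.  (There is at most one such `T`.) -/
def POVM.IsIntegral (A : POVM X H) (f : X → ℂ) (T : H →L[ℂ] H) : Prop :=
  ∀ v w : H, ⟪w, T v⟫_ℂ = (A.coeff v w).integral f (ContinuousLinearMap.mul ℝ ℂ)

variable (X H) in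
/-- An asymptotic spectral measure on `(X, Σ, 𝓔)`.  The upper limit is taken in `[0,∞]`, so that
it is not affected by unboundedness. -/
structure ASM (𝓔 : Set (Set X)) where
  toPOVM : Planck → POVM X H
  limsup_le : limsup (fun ħ => ‖toPOVM ħ Set.univ‖ₑ) toZero ≤ 1
  continuous_apply : ∀ Δ ∈ 𝓔, Continuous fun ħ => toPOVM ħ Δ
  asymp_proj : ∀ Δ₁ ∈ 𝓔, ∀ Δ₂ ∈ 𝓔,
    Tendsto (fun ħ => ‖toPOVM ħ (Δ₁ ∩ Δ₂) - toPOVM ħ Δ₁ * toPOVM ħ Δ₂‖) toZero (𝓝 0)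

/-- Asymptotic equivalence of asymptotic spectral measures. -/
def ASM.Equivalent {𝓔 : Set (Set X)} (A A' : ASM X H 𝓔) : Prop :=
  ∀ Δ ∈ 𝓔, Tendsto (fun ħ => ‖A.toPOVM ħ Δ - A'.toPOVM ħ Δ‖) toZero (𝓝 0)

/-- The total masses `‖A_ħ(X)‖`, `ħ ∈ (0,1]`, are bounded. -/
def ASM.UniformlyBounded {𝓔 : Set (Set X)} (A : ASM X H 𝓔) : Prop :=
  ∃ C : ℝ, ∀ ħ, ‖A.toPOVM ħ Set.univ‖ ≤ C

end POVMs

/-! ### Locally `B`-valued Borel asymptotic spectral measures -/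

section Borel

/-- The pre-compact open subsets of `X`. -/
def precompactOpens (X : Type*) [TopologicalSpace X] : Set (Set X) :=
  {U | IsOpen U ∧ IsCompact (closure U)}

/-- `B_0(X)`: the C*-algebra of bounded functions on `X` generated by the characteristic functions
of pre-compact open sets.  It consists of bounded Borel functions, and it is the same whether
generated inside all bounded functions or inside the bounded Borel functions. -/
def B0 (X : Type*) [TopologicalSpace X] :
    NonUnitalStarSubalgebra ℂ (lp (fun _ : X => ℂ) ∞) :=
  (NonUnitalStarAlgebra.adjoin ℂ
    {f : lp (fun _ : X => ℂ) ∞ |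
      ∃ U ∈ precompactOpens X, ∀ x, f x = U.indicator (fun _ => (1 : ℂ)) x}).topologicalClosure

instance isClosed_B0 (X : Type*) [TopologicalSpace X] :
    IsClosed (B0 X : Set (lp (fun _ : X => ℂ) ∞)) :=
  isClosed_topologicalClosure _

variable {H : Type*} [NormedAddCommGroup H] [InnerProductSpace ℂ H] [CompleteSpace H]

/-- A (not necessarily closed) `*`-subalgebra of `B(H)` is hereditary if `0 ≤ b ≤ a` and `a` in the
subalgebra imply that `b` is in it. -/
def IsHereditary (B : NonUnitalStarSubalgebra ℂ (H →L[ℂ] H)) : Prop :=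
  ∀ a ∈ B, ∀ b : H →L[ℂ] H, 0 ≤ b → b ≤ a → b ∈ B

variable (X : Type*) [TopologicalSpace X] [MeasurableSpace X]
  (B : NonUnitalStarSubalgebra ℂ (H →L[ℂ] H))

/-- The locally `B`-valued Borel asymptotic spectral measures
`{A_ħ} : (Σ_X, 𝓒_X) → (B(H), B)`. -/
def LocalASM : Type _ :=
  {A : ASM X H (precompactOpens X) // ∀ ħ, ∀ U ∈ precompactOpens X, A.toPOVM ħ U ∈ B}

/-- Asymptotic equivalence as a setoid. -/
def LocalASM.setoid : Setoid (LocalASM X B) where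
  r A A' := A.1.Equivalent A'.1
  iseqv :=
    { refl := fun A U _ => by simpa using tendsto_const_nhds
      symm := fun h U hU => by simpa only [norm_sub_rev] using h U hU
      trans := fun h₁ h₂ U hU => tendsto_norm_sub_trans (h₁ U hU) (h₂ U hU) }

/-- The set `((X, B))` of equivalence classes of locally `B`-valued Borel asymptotic spectral
measures. -/
def ASMClasses : Type _ := Quotient (LocalASM.setoid X B)

variable {X B}

/-- The class `((A_ħ))`. -/
def LocalASM.cls (A : LocalASM X B) : ASMClasses X B := Quotient.mk (LocalASM.setoid X B) A

/-- `Q_ħ(f) = ∫ f dA_ħ` for all `f ∈ B_0(X)`, at the given value of `ħ`. -/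
def LocalASM.RepresentsAt (A : LocalASM X B) (Q : PosAsymptoticMorphism (B0 X) (H →L[ℂ] H))
    (ħ : Planck) : Prop :=
  ∀ f : B0 X, (A.1.toPOVM ħ).IsIntegral (fun x => (f : lp (fun _ : X => ℂ) ∞) x) (Q.toMap ħ f)

/-- `Q_ħ(f) = ∫ f dA_ħ` for all `f ∈ C_0(X)`, at the given value of `ħ`. -/
def LocalASM.RepresentsCPAt (A : LocalASM X B)
    (R : CPAsymptoticMorphism C₀(X, ℂ) B.topologicalClosure) (ħ : Planck) : Prop :=
  ∀ h : C₀(X, ℂ), (A.1.toPOVM ħ).IsIntegral h (R.toMap ħ h : H →L[ℂ] H)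

/-- `{Q_ħ}` maps `C_0(X)` into the closure of `B`, and `C_c(X)` into `B`. -/
def MapsC0Into (B : NonUnitalStarSubalgebra ℂ (H →L[ℂ] H))
    (Q : PosAsymptoticMorphism (B0 X) (H →L[ℂ] H)) : Prop :=
  ∀ (f : B0 X) (h : C₀(X, ℂ)), (∀ x, (f : lp (fun _ : X => ℂ) ∞) x = h x) →
    ∀ ħ, Q.toMap ħ f ∈ B.topologicalClosure ∧ (HasCompactSupport h → Q.toMap ħ f ∈ B)

end Borel

end AsymSpec

end

/-!
Integration against a positive operator-valued measure `A` with bounded total mass is a positive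
linear map `f ↦ ∫ f dA`, here `POVM.op A`, on the bounded measurable functions, with
`‖∫ f dA‖ ≤ sup |f| ‖A(X)‖`.  To construct it, the Cauchy–Schwarz inequality for the positive forms
`⟨A(Δ) v, w⟩` bounds the variation of the complex measures `⟨A(·) v, w⟩` by half the sum of the
positive measures `⟨A(·) v, v⟩` and `⟨A(·) w, w⟩`; so `(v, w) ↦ ∫ f(x) ⟨dA(x) v, w⟩` is a bounded
sesquilinear form (`POVM.exists_isIntegral`).

Since the precompact open sets are closed under intersection, the span of their characteristic
functions is a `*`-algebra, dense in `B₀(X)`.  On a characteristic function `χ_U` the integral is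
`A(U)`, so continuity in `ħ`, asymptotic multiplicativity and asymptotic equivalence on `B₀(X)` are
exactly the defining conditions on the sets `U`, carried over by linearity and by uniform
approximation (`B0_induction`, `continuous_op_B0`, `tendsto_mulDefect`, `tendsto_op_sub_op`).  The
approximation needs bounded total masses.  These are bounded for small `ħ` by the condition on the
upper limit, and replacing `ħ` by `min ħ δ` makes them bounded on all of `(0,1]`
(`ASM.exists_truncation`).

`C₀(X) ⊆ B₀(X)`, because `g ≥ 0` is the uniform limit of `(1/n) ∑ₖ χ_{g > k/n}`
(`toBddFun_mem_B0`).  If `0 ≤ g ≤ C` is supported in a precompact open set `U`, then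
`0 ≤ ∫ g dA ≤ C A(U)`, and heredity gives `∫ g dA ∈ 𝓑` (`op_mem_of_support`); cutting a function in
`C₀(X)` off to `{|h| > δ}` puts its integral in the closure of `𝓑`.  Complete positivity amounts to
positivity of the operator matrices `∫ F(x)* F(x) dA(x)`; for a simple function `F` these are sums
of matrices `D* D`, and the general case is a limit (`gram_nonneg`).
-/

namespace AsymSpec

open scoped ComplexOrder

/-! ### Integrals of bounded measurable functions -/

/-- A bounded measurable complex function. -/
structure IsBddMeas {X : Type*} [MeasurableSpace X] (f : X → ℂ) : Prop where
  measurable : Measurable f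
  bdd : ∃ C : ℝ, ∀ x, ‖f x‖ ≤ C

/-- The product of complex numbers as the pairing used for integrals against complex measures. -/
local notation "𝔪" => ContinuousLinearMap.mul ℝ ℂ

section Bounded

variable {X : Type*} [MeasurableSpace X]

namespace IsBddMeas

theorem add {f g : X → ℂ} (hf : IsBddMeas f) (hg : IsBddMeas g) :
    IsBddMeas (fun x => f x + g x) := by
  obtain ⟨C, hC⟩ := hf.bdd
  obtain ⟨D, hD⟩ := hg.bdd
  exact ⟨hf.measurable.add hg.measurable,
    C + D, fun x => (norm_add_le _ _).trans (add_le_add (hC x) (hD x))⟩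

theorem mul {f g : X → ℂ} (hf : IsBddMeas f) (hg : IsBddMeas g) :
    IsBddMeas (fun x => f x * g x) := by
  obtain ⟨C, hC⟩ := hf.bdd
  obtain ⟨D, hD⟩ := hg.bdd
  refine ⟨hf.measurable.mul hg.measurable, C * D, fun x => ?_⟩
  rw [norm_mul]
  exact mul_le_mul (hC x) (hD x) (norm_nonneg _) ((norm_nonneg _).trans (hC x))

theorem const (c : ℂ) : IsBddMeas (fun _ : X => c) := ⟨measurable_const, ‖c‖, fun _ => le_rfl⟩

theorem const_mul (c : ℂ) {f : X → ℂ} (hf : IsBddMeas f) : IsBddMeas (fun x => c * f x) :=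
  (const c).mul hf

theorem sub {f g : X → ℂ} (hf : IsBddMeas f) (hg : IsBddMeas g) :
    IsBddMeas (fun x => f x - g x) := by
  simpa [sub_eq_add_neg] using hf.add (hg.const_mul (-1))

theorem star {f : X → ℂ} (hf : IsBddMeas f) : IsBddMeas (fun x => star (f x)) := by
  obtain ⟨C, hC⟩ := hf.bdd
  exact ⟨continuous_star.measurable.comp hf.measurable, C, fun x => by simpa using hC x⟩

theorem indicator {s : Set X} (hs : MeasurableSet s) {f : X → ℂ} (hf : IsBddMeas f) :
    IsBddMeas (s.indicator f) := by
  obtain ⟨C, hC⟩ := hf.bdd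
  exact ⟨hf.measurable.indicator hs, C, fun x => (norm_indicator_le_norm_self _ _).trans (hC x)⟩

theorem indicator_const {s : Set X} (hs : MeasurableSet s) (c : ℂ) :
    IsBddMeas (s.indicator fun _ => c) :=
  (const c).indicator hs

theorem sum {ι : Type*} (t : Finset ι) {f : ι → X → ℂ} (hf : ∀ i ∈ t, IsBddMeas (f i)) :
    IsBddMeas (fun x => ∑ i ∈ t, f i x) := by
  classical
  induction t using Finset.induction_on with
  | empty => simpa using const 0
  | insert a t ha ih =>
    simp only [Finset.sum_insert ha]
    exact (hf a (by simp)).add (ih fun i hi => hf i (by simp [hi]))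

theorem integrable {f : X → ℂ} (hf : IsBddMeas f) (μ : Measure X) [IsFiniteMeasure μ] :
    Integrable f μ := by
  obtain ⟨C, hC⟩ := hf.bdd
  exact Integrable.of_bound hf.measurable.aestronglyMeasurable C (Eventually.of_forall hC)

/-- A property of functions that holds for multiples of characteristic functions and passes to sums
and to bounded pointwise limits holds for all bounded measurable functions. -/
theorem induction {P : (X → ℂ) → Prop}
    (ind : ∀ (c : ℂ) (s : Set X), MeasurableSet s → P (s.indicator fun _ => c))
    (add : ∀ f g : X → ℂ, IsBddMeas f → IsBddMeas g → P f → P g → P (f + g))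
    (lim : ∀ (F : ℕ → X → ℂ) (f : X → ℂ) (C : ℝ), (∀ n, Measurable (F n)) →
      (∀ n x, ‖F n x‖ ≤ C) → (∀ x, Tendsto (fun n => F n x) atTop (𝓝 (f x))) →
      (∀ n, P (F n)) → P f)
    {f : X → ℂ} (hf : IsBddMeas f) : P f := by
  obtain ⟨C, hC⟩ := hf.bdd
  have hsm : StronglyMeasurable f := hf.measurable.stronglyMeasurable
  rcases isEmpty_or_nonempty X with hX | ⟨⟨x₀⟩⟩
  · have : f = (∅ : Set X).indicator fun _ => 0 := Subsingleton.elim _ _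
    rw [this]
    exact ind _ _ MeasurableSet.empty
  have hC0 : 0 ≤ C := (norm_nonneg _).trans (hC x₀)
  have hsimple : ∀ F : SimpleFunc X ℂ, P F := fun F => by
    refine SimpleFunc.induction (motive := fun F : SimpleFunc X ℂ => P F) ?_ ?_ F
    · intro c s hs
      convert ind c s hs using 1
      ext x
      by_cases hx : x ∈ s <;> simp [hx]
    · intro f g _ hf hg
      exact add _ _ ⟨f.measurable, f.exists_forall_norm_le⟩ ⟨g.measurable, g.exists_forall_norm_le⟩
        hf hg
  exact lim (fun n => hsm.approxBounded C n) f C (fun n => (hsm.approxBounded C n).measurable)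
    (fun n x => hsm.norm_approxBounded_le hC0 n x)
    (fun x => hsm.tendsto_approxBounded_of_norm_le (hC x)) fun n => hsimple _

end IsBddMeas

theorem norm_mul_pairing : ‖𝔪‖ ≤ 1 := ContinuousLinearMap.opNorm_mul_le ℝ ℂ

theorem integral_const_mul_vectorMeasure (μ : ComplexMeasure X) (c : ℂ) (f : X → ℂ) :
    μ.integral (fun x => c * f x) 𝔪 = c * μ.integral f 𝔪 := by
  rw [VectorMeasure.integral_eq_setToFun, VectorMeasure.integral_eq_setToFun]
  refine setToFun_smul (𝕜 := ℂ) _ ?_ c f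
  intro c s x
  simp [transpose_eq_cbmApplyMeasure, mul_assoc]

theorem tendsto_integral_of_bdd (μ : ComplexMeasure X) [IsFiniteMeasure μ.variation]
    {F : ℕ → X → ℂ} {f : X → ℂ} {C : ℝ} (hF : ∀ n, Measurable (F n)) (hC : ∀ n x, ‖F n x‖ ≤ C)
    (hl : ∀ x, Tendsto (fun n => F n x) atTop (𝓝 (f x))) :
    Tendsto (fun n => μ.integral (F n) 𝔪) atTop (𝓝 (μ.integral f 𝔪)) :=
  VectorMeasure.tendsto_integral_of_dominated_convergence (fun _ => C)
    (fun n => (hF n).aestronglyMeasurable) (integrable_const C)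
    (fun n => Eventually.of_forall (hC n)) (Eventually.of_forall hl)

theorem integral_indicator_vectorMeasure (μ : ComplexMeasure X) [IsFiniteMeasure μ.variation]
    (c : ℂ) {s : Set X} (hs : MeasurableSet s) :
    μ.integral (s.indicator fun _ => c) 𝔪 = c * μ s := by
  simpa using VectorMeasure.integral_indicator_const (μ := μ) (B := 𝔪) c hs

/-- Integrals are complex linear in the measure: if `ν = c μ` then `∫ f dν = c ∫ f dμ`. -/
theorem integral_smul_complexMeasure {μ ν : ComplexMeasure X} [IsFiniteMeasure μ.variation]
    [IsFiniteMeasure ν.variation] {c : ℂ} (h : ∀ s, MeasurableSet s → ν s = c * μ s) {f : X → ℂ}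
    (hf : IsBddMeas f) : ν.integral f 𝔪 = c * μ.integral f 𝔪 := by
  refine hf.induction (P := fun f => ν.integral f 𝔪 = c * μ.integral f 𝔪) ?_ ?_ ?_
  · intro d s hs
    rw [integral_indicator_vectorMeasure _ _ hs, integral_indicator_vectorMeasure _ _ hs, h s hs]
    ring
  · intro f g hf hg hf' hg'
    rw [VectorMeasure.integral_add (hf.integrable _) (hg.integrable _),
      VectorMeasure.integral_add (hf.integrable _) (hg.integrable _), hf', hg', mul_add]
  · intro F f C hF hC hl hP
    refine tendsto_nhds_unique (tendsto_integral_of_bdd ν hF hC hl) ?_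
    simp only [hP]
    exact (tendsto_integral_of_bdd μ hF hC hl).const_mul c

/-- The integral against a complex measure that is a positive measure is the Bochner integral. -/
theorem integral_eq_integral_measure {ν : ComplexMeasure X} [IsFiniteMeasure ν.variation]
    {μ : Measure X} [IsFiniteMeasure μ] (h : ∀ s, MeasurableSet s → ν s = (μ.real s : ℂ))
    {f : X → ℂ} (hf : IsBddMeas f) : ν.integral f 𝔪 = ∫ x, f x ∂μ := by
  refine hf.induction (P := fun f => ν.integral f 𝔪 = ∫ x, f x ∂μ) ?_ ?_ ?_
  · intro d s hs
    rw [integral_indicator_vectorMeasure _ _ hs, MeasureTheory.integral_indicator_const _ hs, h s hs]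
    simp [mul_comm]
  · intro f g hf hg hf' hg'
    rw [VectorMeasure.integral_add (hf.integrable _) (hg.integrable _),
      MeasureTheory.integral_add' (hf.integrable _) (hg.integrable _), hf', hg']
  · intro F f C hF hC hl hP
    refine tendsto_nhds_unique (tendsto_integral_of_bdd ν hF hC hl) ?_
    simp only [hP]
    exact MeasureTheory.tendsto_integral_of_dominated_convergence (fun _ => C)
      (fun n => (hF n).aestronglyMeasurable) (integrable_const C)
      (fun n => Eventually.of_forall (hC n)) (Eventually.of_forall hl)

end Bounded

/-! ### Integration against a positive operator-valued measure -/

namespace POVM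

variable {X : Type*} [MeasurableSpace X]
  {H : Type*} [NormedAddCommGroup H] [InnerProductSpace ℂ H] [CompleteSpace H]

omit [CompleteSpace H] in
theorem nonneg (A : POVM X H) (s : Set X) : 0 ≤ A s := by
  by_cases hs : MeasurableSet s
  · exact A.nonneg' s hs
  · exact (A.not_measurable' s hs).ge

omit [CompleteSpace H] in
theorem inner_self_nonneg (A : POVM X H) (s : Set X) (v : H) : 0 ≤ ⟪v, A s v⟫_ℂ :=
  ((ContinuousLinearMap.nonneg_iff_isPositive _).1 (A.nonneg s)).inner_nonneg_right v

omit [CompleteSpace H] in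
theorem inner_self_eq_re (A : POVM X H) (s : Set X) (v : H) :
    ⟪v, A s v⟫_ℂ = ((⟪v, A s v⟫_ℂ).re : ℂ) :=
  Complex.ext rfl (by simpa using (Complex.nonneg_iff.1 (A.inner_self_nonneg s v)).2.symm)

/-- The positive measure `Δ ↦ ⟨A(Δ) v, v⟩`. -/
noncomputable def diag (A : POVM X H) (v : H) : Measure X :=
  Measure.ofMeasurable (fun s _ => ENNReal.ofReal (⟪v, A s v⟫_ℂ).re) (by simp [A.empty'])
    fun s hs hd => by
      have h := Complex.hasSum_re (A.iUnion' s hs hd v v)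
      rw [← h.tsum_eq, ENNReal.ofReal_tsum_of_nonneg _ h.summable]
      exact fun n => (Complex.nonneg_iff.1 (A.inner_self_nonneg (s n) v)).1

omit [CompleteSpace H] in
theorem diag_apply (A : POVM X H) (v : H) {s : Set X} (hs : MeasurableSet s) :
    A.diag v s = ENNReal.ofReal (⟪v, A s v⟫_ℂ).re :=
  Measure.ofMeasurable_apply s hs

omit [CompleteSpace H] in
theorem diag_real_apply (A : POVM X H) (v : H) {s : Set X} (hs : MeasurableSet s) :
    (A.diag v).real s = (⟪v, A s v⟫_ℂ).re := by
  rw [measureReal_def, diag_apply _ _ hs, ENNReal.toReal_ofReal]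
  exact (Complex.nonneg_iff.1 (A.inner_self_nonneg s v)).1

instance (A : POVM X H) (v : H) : IsFiniteMeasure (A.diag v) :=
  ⟨by rw [diag_apply _ _ MeasurableSet.univ]; exact ENNReal.ofReal_lt_top⟩

omit [CompleteSpace H] in
theorem diag_real_univ_le (A : POVM X H) (v : H) :
    (A.diag v).real Set.univ ≤ ‖A Set.univ‖ * ‖v‖ ^ 2 := by
  rw [diag_real_apply _ _ MeasurableSet.univ]
  calc (⟪v, A Set.univ v⟫_ℂ).re ≤ ‖⟪v, A Set.univ v⟫_ℂ‖ := Complex.re_le_norm _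
    _ ≤ ‖v‖ * ‖A Set.univ v‖ := norm_inner_le_norm _ _
    _ ≤ ‖v‖ * (‖A Set.univ‖ * ‖v‖) := by gcongr; exact (A Set.univ).le_opNorm v
    _ = _ := by ring

/-- The Cauchy–Schwarz inequality for the positive form `⟨A(Δ) ·, ·⟩`, combined with the
arithmetic-geometric mean inequality. -/
theorem norm_inner_le (A : POVM X H) (s : Set X) (v w : H) :
    ‖⟪w, A s v⟫_ℂ‖ ≤ ((⟪v, A s v⟫_ℂ).re + (⟪w, A s w⟫_ℂ).re) / 2 := by
  obtain ⟨C, hC⟩ := CStarAlgebra.nonneg_iff_eq_star_mul_self.1 (A.nonneg s)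
  have key : ∀ x y : H, ⟪x, A s y⟫_ℂ = ⟪C x, C y⟫_ℂ := fun x y => by
    rw [hC, ContinuousLinearMap.star_eq_adjoint]
    exact ContinuousLinearMap.adjoint_inner_right C x (C y)
  have hre : ∀ x : H, (⟪x, A s x⟫_ℂ).re = ‖C x‖ ^ 2 := fun x => by
    rw [key, inner_self_eq_norm_sq_to_K]
    norm_cast
  rw [hre, hre, key]
  have := norm_inner_le_norm (𝕜 := ℂ) (C w) (C v)
  nlinarith [sq_nonneg (‖C v‖ - ‖C w‖)]

omit [CompleteSpace H] in
@[simp]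
theorem coeff_apply (A : POVM X H) (v w : H) (s : Set X) : A.coeff v w s = ⟪w, A s v⟫_ℂ := rfl

theorem variation_coeff_le (A : POVM X H) (v w : H) :
    (A.coeff v w).variation ≤ (2⁻¹ : NNReal) • (A.diag v + A.diag w) := by
  refine VectorMeasure.variation_le_of_forall_enorm_le fun s hs => ?_
  have h1 := (Complex.nonneg_iff.1 (A.inner_self_nonneg s v)).1
  have h2 := (Complex.nonneg_iff.1 (A.inner_self_nonneg s w)).1
  rw [Measure.smul_apply, Measure.add_apply, diag_apply _ _ hs, diag_apply _ _ hs,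
    ← ENNReal.ofReal_add h1 h2, coeff_apply, ← ofReal_norm]
  refine (ENNReal.ofReal_le_ofReal (A.norm_inner_le s v w)).trans_eq ?_
  rw [div_eq_inv_mul, ENNReal.ofReal_mul (by norm_num), ENNReal.smul_def, smul_eq_mul]
  congr 1
  rw [ENNReal.ofReal_inv_of_pos two_pos]
  simp

instance (A : POVM X H) (v w : H) : IsFiniteMeasure (A.coeff v w).variation :=
  isFiniteMeasure_of_le _ (A.variation_coeff_le v w)

theorem variation_coeff_real_univ_le (A : POVM X H) (v w : H) :
    (A.coeff v w).variation.real Set.univ ≤ ‖A Set.univ‖ * ((‖v‖ ^ 2 + ‖w‖ ^ 2) / 2) := by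
  have h := ENNReal.toReal_mono (measure_ne_top _ _) (A.variation_coeff_le v w Set.univ)
  have h' : ((2⁻¹ : NNReal) • (A.diag v + A.diag w)).real Set.univ
      = 2⁻¹ * ((A.diag v).real Set.univ + (A.diag w).real Set.univ) := by
    rw [measureReal_nnreal_smul_apply, measureReal_add_apply]
    simp
  have h1 := A.diag_real_univ_le v
  have h2 := A.diag_real_univ_le w
  change (A.coeff v w).variation.real Set.univ
    ≤ ((2⁻¹ : NNReal) • (A.diag v + A.diag w)).real Set.univ at h
  rw [h'] at h
  nlinarith

/-- The sesquilinear form `(v, w) ↦ ∫ f(x) ⟨dA(x) v, w⟩`. -/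
noncomputable def form (A : POVM X H) (f : X → ℂ) (v w : H) : ℂ := (A.coeff v w).integral f 𝔪

section Form

variable (A : POVM X H) {f : X → ℂ} (hf : IsBddMeas f)
include hf

theorem form_add_left (v v' w : H) : A.form f (v + v') w = A.form f v w + A.form f v' w := by
  have h : A.coeff (v + v') w = A.coeff v w + A.coeff v' w := by
    ext s hs
    simp
  rw [form, h, VectorMeasure.integral_add_vectorMeasure (hf.integrable _) (hf.integrable _)]
  rfl

theorem form_add_right (v w w' : H) : A.form f v (w + w') = A.form f v w + A.form f v w' := by
  have h : A.coeff v (w + w') = A.coeff v w + A.coeff v w' := by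
    ext s hs
    simp
  rw [form, h, VectorMeasure.integral_add_vectorMeasure (hf.integrable _) (hf.integrable _)]
  rfl

theorem form_smul_left (c : ℂ) (v w : H) : A.form f (c • v) w = c * A.form f v w :=
  integral_smul_complexMeasure (fun s _ => by simp) hf

theorem form_smul_right (c : ℂ) (v w : H) :
    A.form f v (c • w) = starRingEnd ℂ c * A.form f v w :=
  integral_smul_complexMeasure (fun s _ => by simp [mul_comm]) hf

omit hf in
theorem norm_form_le_add {C : ℝ} (hC : ∀ x, ‖f x‖ ≤ C) (hC0 : 0 ≤ C) (v w : H) :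
    ‖A.form f v w‖ ≤ C * ‖A Set.univ‖ * ((‖v‖ ^ 2 + ‖w‖ ^ 2) / 2) := by
  refine (VectorMeasure.norm_integral_le_of_norm_le_const (Eventually.of_forall hC)).trans ?_
  have h1 := A.variation_coeff_real_univ_le v w
  calc C * ‖𝔪‖ * (A.coeff v w).variation.real Set.univ
      ≤ C * 1 * (‖A Set.univ‖ * ((‖v‖ ^ 2 + ‖w‖ ^ 2) / 2)) := by
        gcongr
        exact norm_mul_pairing
    _ = _ := by ring

/-- The bound by the product of the norms follows from `norm_form_le_add` by homogeneity. -/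
theorem norm_form_le {C : ℝ} (hC : ∀ x, ‖f x‖ ≤ C) (hC0 : 0 ≤ C) (v w : H) :
    ‖A.form f v w‖ ≤ C * ‖A Set.univ‖ * ‖v‖ * ‖w‖ := by
  rcases eq_or_ne v 0 with rfl | hv
  · have : A.form f 0 w = 0 := by simpa using A.form_smul_left hf 0 0 w
    simp [this]
  rcases eq_or_ne w 0 with rfl | hw
  · have : A.form f v 0 = 0 := by simpa using A.form_smul_right hf 0 v 0
    simp [this]
  have hv' : 0 < ‖v‖ := norm_pos_iff.2 hv
  have hw' : 0 < ‖w‖ := norm_pos_iff.2 hw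
  have h := A.norm_form_le_add hC hC0 (((‖v‖ : ℂ)⁻¹) • v) (((‖w‖ : ℂ)⁻¹) • w)
  rw [form_smul_left A hf, form_smul_right A hf] at h
  simp only [norm_mul, norm_inv, norm_smul, Complex.norm_real, norm_norm, map_inv₀,
    Complex.conj_ofReal, inv_mul_cancel₀ hv'.ne', inv_mul_cancel₀ hw'.ne'] at h
  have h2 : ‖v‖⁻¹ * (‖w‖⁻¹ * ‖A.form f v w‖) = ‖A.form f v w‖ / (‖v‖ * ‖w‖) := by
    field_simp
  rw [h2, div_le_iff₀ (by positivity)] at h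
  linarith

theorem exists_isIntegral {C : ℝ} (hC : ∀ x, ‖f x‖ ≤ C) (hC0 : 0 ≤ C) :
    ∃ T : H →L[ℂ] H, A.IsIntegral f T ∧ ‖T‖ ≤ C * ‖A Set.univ‖ := by
  let S : H →ₗ⋆[ℂ] H →ₗ[ℂ] ℂ := LinearMap.mk₂'ₛₗ (starRingEnd ℂ) (RingHom.id ℂ)
    (fun w v => A.form f v w) (fun w w' v => A.form_add_right hf v w w')
    (fun c w v => A.form_smul_right hf c v w) (fun w v v' => A.form_add_left hf v v' w)
    (fun c w v => A.form_smul_left hf c v w)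
  have hS : ∀ w v, ‖S w v‖ ≤ C * ‖A Set.univ‖ * ‖w‖ * ‖v‖ := fun w v =>
    (A.norm_form_le hf hC hC0 v w).trans_eq (by ring)
  let S' : H →L⋆[ℂ] H →L[ℂ] ℂ := LinearMap.mkContinuous₂ S (C * ‖A Set.univ‖) hS
  let T := ContinuousLinearMap.adjoint (InnerProductSpace.continuousLinearMapOfBilin S')
  have hT : A.IsIntegral f T := fun v w => by
    rw [ContinuousLinearMap.adjoint_inner_right,
      InnerProductSpace.continuousLinearMapOfBilin_apply]
    rfl
  refine ⟨T, hT, ContinuousLinearMap.opNorm_le_bound _ (by positivity) fun v => ?_⟩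
  rcases eq_or_ne (T v) 0 with h0 | h0
  · rw [h0, norm_zero]
    positivity
  have h := A.norm_form_le hf hC hC0 v (T v)
  have h1 : A.form f v (T v) = ⟪T v, T v⟫_ℂ := (hT v (T v)).symm
  rw [h1, inner_self_eq_norm_sq_to_K, norm_pow, RCLike.norm_ofReal, abs_norm, pow_two] at h
  exact le_of_mul_le_mul_right h (norm_pos_iff.2 h0)

end Form

omit [CompleteSpace H] in
theorem IsIntegral.unique {A : POVM X H} {f : X → ℂ} {S T : H →L[ℂ] H} (hS : A.IsIntegral f S)
    (hT : A.IsIntegral f T) : S = T :=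
  ContinuousLinearMap.ext fun v => ext_inner_left ℂ fun w => (hS v w).trans (hT v w).symm

open Classical in
/-- The operator `∫ f dA`, with the value `0` if the integral does not exist as a bounded
operator. -/
noncomputable def op (A : POVM X H) (f : X → ℂ) : H →L[ℂ] H :=
  if h : ∃ T, A.IsIntegral f T then h.choose else 0

omit [CompleteSpace H] in
theorem IsIntegral.op_eq {A : POVM X H} {f : X → ℂ} {T : H →L[ℂ] H} (hT : A.IsIntegral f T) :
    A.op f = T := by
  have h : ∃ T, A.IsIntegral f T := ⟨T, hT⟩
  rw [op, dif_pos h]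
  exact h.choose_spec.unique hT

variable (A : POVM X H) {f g : X → ℂ}

theorem isIntegral_op (hf : IsBddMeas f) : A.IsIntegral f (A.op f) := by
  obtain ⟨C, hC⟩ := hf.bdd
  obtain ⟨T, hT, -⟩ := A.exists_isIntegral hf (fun x => (hC x).trans (le_abs_self C)) (abs_nonneg C)
  rwa [hT.op_eq]

theorem norm_op_le (hf : IsBddMeas f) {C : ℝ} (hC0 : 0 ≤ C) (hC : ∀ x, ‖f x‖ ≤ C) :
    ‖A.op f‖ ≤ C * ‖A Set.univ‖ := by
  obtain ⟨T, hT, h⟩ := A.exists_isIntegral hf hC hC0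
  rwa [hT.op_eq]

theorem op_add (hf : IsBddMeas f) (hg : IsBddMeas g) :
    A.op (fun x => f x + g x) = A.op f + A.op g := by
  refine IsIntegral.op_eq fun v w => ?_
  rw [add_apply, inner_add_right, A.isIntegral_op hf v w,
    A.isIntegral_op hg v w]
  exact (VectorMeasure.integral_add (hf.integrable _) (hg.integrable _)).symm

theorem op_const_mul (c : ℂ) (hf : IsBddMeas f) : A.op (fun x => c * f x) = c • A.op f := by
  refine IsIntegral.op_eq fun v w => ?_
  rw [smul_apply, inner_smul_right, A.isIntegral_op hf v w,
    integral_const_mul_vectorMeasure]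

theorem op_sub (hf : IsBddMeas f) (hg : IsBddMeas g) :
    A.op (fun x => f x - g x) = A.op f - A.op g := by
  have h := A.op_add hf (hg.const_mul (-1))
  rw [A.op_const_mul _ hg] at h
  simpa [← sub_eq_add_neg] using h

theorem op_indicator {s : Set X} (hs : MeasurableSet s) (c : ℂ) :
    A.op (s.indicator fun _ => c) = c • A s := by
  refine IsIntegral.op_eq fun v w => ?_
  rw [integral_indicator_vectorMeasure _ _ hs, smul_apply, inner_smul_right,
    coeff_apply]

theorem op_sum {ι : Type*} (t : Finset ι) {f : ι → X → ℂ} (hf : ∀ i ∈ t, IsBddMeas (f i)) :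
    A.op (fun x => ∑ i ∈ t, f i x) = ∑ i ∈ t, A.op (f i) := by
  classical
  induction t using Finset.induction_on with
  | empty => simpa using A.op_const_mul 0 (IsBddMeas.const 0)
  | insert a t ha ih =>
    simp only [Finset.sum_insert ha]
    rw [op_add A (hf a (by simp)) (IsBddMeas.sum t fun i hi => hf i (by simp [hi])),
      ih fun i hi => hf i (by simp [hi])]

theorem op_nonneg (hf : IsBddMeas f) (h0 : ∀ x, 0 ≤ f x) : 0 ≤ A.op f := by
  rw [ContinuousLinearMap.nonneg_iff_isPositive, ContinuousLinearMap.isPositive_iff_complex]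
  have key : ∀ v : H, 0 ≤ ⟪v, A.op f v⟫_ℂ := fun v => by
    rw [A.isIntegral_op hf v v, integral_eq_integral_measure (μ := A.diag v) _ hf]
    · have h1 : ∀ x, f x = ((f x).re : ℂ) := fun x =>
        Complex.ext rfl (by simpa using (Complex.nonneg_iff.1 (h0 x)).2.symm)
      rw [MeasureTheory.integral_congr_ae (Eventually.of_forall h1), integral_complex_ofReal]
      exact_mod_cast integral_nonneg fun x => (Complex.nonneg_iff.1 (h0 x)).1
    · intro s hs
      rw [diag_real_apply _ _ hs, coeff_apply]
      exact A.inner_self_eq_re s v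
  intro v
  have h := Complex.nonneg_iff.1 (key v)
  have hv : ⟪A.op f v, v⟫_ℂ = ⟪v, A.op f v⟫_ℂ := by
    rw [← inner_conj_symm, Complex.conj_eq_iff_im.2 h.2.symm]
  rw [hv]
  exact ⟨Complex.ext rfl (by simpa using h.2), h.1⟩

theorem op_mono (hf : IsBddMeas f) (hg : IsBddMeas g) (h : ∀ x, f x ≤ g x) :
    A.op f ≤ A.op g := by
  rw [← sub_nonneg, ← A.op_sub hg hf]
  exact A.op_nonneg (hg.sub hf) fun x => sub_nonneg.2 (h x)

end POVM

/-! ### The algebra generated by characteristic functions of precompact open sets -/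

section BoundedFunctions

variable {X : Type*}

/-- A bounded function as an element of `ℓ^∞(X)`. -/
def toBddFun (f : X → ℂ) (hf : ∃ C : ℝ, ∀ x, ‖f x‖ ≤ C) : lp (fun _ : X => ℂ) ∞ :=
  ⟨f, memℓp_infty (by obtain ⟨C, hC⟩ := hf; exact ⟨C, by rintro _ ⟨x, rfl⟩; exact hC x⟩)⟩

@[simp]
theorem toBddFun_apply (f : X → ℂ) (hf : ∃ C : ℝ, ∀ x, ‖f x‖ ≤ C) (x : X) :
    toBddFun f hf x = f x := rfl

/-- The characteristic function of a set as an element of `ℓ^∞(X)`. -/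
noncomputable def chi (U : Set X) : lp (fun _ : X => ℂ) ∞ :=
  toBddFun (U.indicator fun _ => 1) ⟨1, fun x => (norm_indicator_le_norm_self _ _).trans (by simp)⟩

theorem coe_chi (U : Set X) : ⇑(chi U) = U.indicator fun _ => (1 : ℂ) := rfl

theorem chi_mul_chi (U V : Set X) : chi U * chi V = chi (U ∩ V) := by
  ext x
  by_cases hU : x ∈ U <;> by_cases hV : x ∈ V <;> simp [coe_chi, hU, hV]

theorem star_chi (U : Set X) : star (chi U) = chi U := by
  ext x
  by_cases hU : x ∈ U <;> simp [coe_chi, hU]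

theorem norm_bddFun_apply_le (f : lp (fun _ : X => ℂ) ∞) (x : X) : ‖f x‖ ≤ ‖f‖ :=
  lp.norm_apply_le_norm ENNReal.top_ne_zero f x

theorem apply_nonneg_of_nonneg {f : lp (fun _ : X => ℂ) ∞} (hf : 0 ≤ f) (x : X) : 0 ≤ f x := by
  rw [StarOrderedRing.nonneg_iff] at hf
  induction hf using AddSubmonoid.closure_induction with
  | mem f hf =>
    obtain ⟨g, rfl⟩ := hf
    simpa using star_mul_self_nonneg (g x)
  | zero => simp
  | add f g _ _ hf hg => simpa using add_nonneg hf hg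

theorem apply_le_of_le {f g : lp (fun _ : X => ℂ) ∞} (h : f ≤ g) (x : X) : f x ≤ g x :=
  sub_nonneg.1 (apply_nonneg_of_nonneg (sub_nonneg.2 h) x)

end BoundedFunctions

section B0

variable {X : Type*} [TopologicalSpace X]

theorem empty_mem_precompactOpens : (∅ : Set X) ∈ precompactOpens X := by
  simp [precompactOpens]

theorem inter_mem_precompactOpens {U V : Set X} (hU : U ∈ precompactOpens X)
    (hV : V ∈ precompactOpens X) : U ∩ V ∈ precompactOpens X :=
  ⟨hU.1.inter hV.1, hU.2.of_isClosed_subset isClosed_closure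
    (closure_mono Set.inter_subset_left)⟩

theorem chi_mem_B0 {U : Set X} (hU : U ∈ precompactOpens X) : chi U ∈ B0 X :=
  NonUnitalStarSubalgebra.le_topologicalClosure _
    (NonUnitalStarAlgebra.subset_adjoin ℂ _ ⟨U, hU, fun _ => rfl⟩)

/-- As the characteristic functions of precompact open sets are self-adjoint and closed under
products, their linear span is already the `*`-algebra that they generate. -/
theorem adjoin_chi_toSubmodule :
    (NonUnitalStarAlgebra.adjoin ℂ {f : lp (fun _ : X => ℂ) ∞ |
      ∃ U ∈ precompactOpens X, ∀ x, f x = U.indicator (fun _ => (1 : ℂ)) x}).toSubmodule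
    = Submodule.span ℂ {f | ∃ U ∈ precompactOpens X, f = chi U} := by
  have hset : {f : lp (fun _ : X => ℂ) ∞ |
      ∃ U ∈ precompactOpens X, ∀ x, f x = U.indicator (fun _ => (1 : ℂ)) x}
      = {f | ∃ U ∈ precompactOpens X, f = chi U} := by
    ext f
    refine exists_congr fun U => and_congr_right fun _ => ⟨fun h => lp.ext (funext h), ?_⟩
    rintro rfl x
    rfl
  have hstar : star {f : lp (fun _ : X => ℂ) ∞ | ∃ U ∈ precompactOpens X, f = chi U}
      = {f | ∃ U ∈ precompactOpens X, f = chi U} := by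
    ext f
    refine exists_congr fun U => and_congr_right fun _ => ?_
    rw [star_eq_iff_star_eq, star_chi, eq_comm]
  rw [hset]
  change (NonUnitalAlgebra.adjoin ℂ _).toSubmodule = _
  rw [NonUnitalAlgebra.adjoin_eq_span, hstar, Set.union_self]
  congr 1
  refine Set.Subset.antisymm (fun f hf => ?_) Subsemigroup.subset_closure
  induction hf using Subsemigroup.closure_induction with
  | mem f hf => exact hf
  | mul f g _ _ hf hg =>
    obtain ⟨U, hU, rfl⟩ := hf
    obtain ⟨V, hV, rfl⟩ := hg
    exact ⟨U ∩ V, inter_mem_precompactOpens hU hV, chi_mul_chi U V⟩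

/-- A property that holds for the characteristic functions of precompact open sets and passes to
linear combinations and uniform limits within `B₀(X)` holds on `B₀(X)`. -/
theorem B0_induction {P : lp (fun _ : X => ℂ) ∞ → Prop}
    (mem : ∀ U ∈ precompactOpens X, P (chi U))
    (add : ∀ f ∈ B0 X, ∀ g ∈ B0 X, P f → P g → P (f + g))
    (smul : ∀ (c : ℂ), ∀ f ∈ B0 X, P f → P (c • f))
    (lim : ∀ f ∈ B0 X, (∀ ε > 0, ∃ g ∈ B0 X, P g ∧ ‖f - g‖ ≤ ε) → P f)
    {f : lp (fun _ : X => ℂ) ∞} (hf : f ∈ B0 X) : P f := by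
  refine lim f hf fun ε hε => ?_
  obtain ⟨g, hg, hfg⟩ := Metric.mem_closure_iff.1 hf ε hε
  have key : g ∈ B0 X ∧ P g := by
    have hg' : g ∈ Submodule.span ℂ {f | ∃ U ∈ precompactOpens X, f = chi U} := by
      rw [← adjoin_chi_toSubmodule]
      exact hg
    clear hg hfg
    induction hg' using Submodule.span_induction with
    | mem g hg =>
      obtain ⟨U, hU, rfl⟩ := hg
      exact ⟨chi_mem_B0 hU, mem U hU⟩
    | zero =>
      have h := mem ∅ empty_mem_precompactOpens
      have h0 : (chi ∅ : lp (fun _ : X => ℂ) ∞) = 0 := by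
        ext x
        simp [coe_chi]
      rw [h0] at h
      exact ⟨zero_mem _, h⟩
    | add f g _ _ hf hg => exact ⟨add_mem hf.1 hg.1, add f hf.1 g hg.1 hf.2 hg.2⟩
    | smul c f _ hf => exact ⟨SMulMemClass.smul_mem c hf.1, smul c f hf.1 hf.2⟩
  exact ⟨g, key.1, key.2, by rw [← dist_eq_norm]; exact hfg.le⟩

theorem isBddMeas_of_mem_B0 [MeasurableSpace X] [BorelSpace X] {f : lp (fun _ : X => ℂ) ∞}
    (hf : f ∈ B0 X) : IsBddMeas f := by
  refine ⟨?_, ‖f‖, norm_bddFun_apply_le f⟩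
  refine B0_induction (P := fun f => Measurable f) ?_ ?_ ?_ ?_ hf
  · exact fun U hU => measurable_const.indicator hU.1.measurableSet
  · exact fun f _ g _ hf hg => hf.add hg
  · exact fun c f _ hf => hf.const_smul c
  · intro f _ h
    choose g _ hg hfg using fun n : ℕ => h (1 / ((n : ℝ) + 1)) Nat.one_div_pos_of_nat
    refine measurable_of_tendsto_metrizable (f := fun n => ⇑(g n)) hg (tendsto_pi_nhds.2 fun x => ?_)
    rw [tendsto_iff_norm_sub_tendsto_zero]
    refine squeeze_zero (fun _ => norm_nonneg _) (fun n => ?_)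
      (tendsto_one_div_add_atTop_nhds_zero_nat (𝕜 := ℝ))
    refine le_trans ?_ (hfg n)
    rw [norm_sub_rev]
    simpa using norm_bddFun_apply_le (f - g n) x

/-- A bounded function `g ≥ 0` all of whose level sets `{g > t}`, `t > 0`, are precompact and open
is the uniform limit of the functions `(1/n) ∑ₖ χ_{g > k/n}`. -/
theorem toBddFun_mem_B0 {g : X → ℝ} (hg0 : ∀ x, 0 ≤ g x)
    (hg : ∀ t : ℝ, 0 < t → {x | t < g x} ∈ precompactOpens X)
    (hb : ∃ C : ℝ, ∀ x, ‖(g x : ℂ)‖ ≤ C) : toBddFun (fun x => (g x : ℂ)) hb ∈ B0 X := by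
  refine Metric.mem_of_closed' (isClosed_B0 X) |>.2 fun ε hε => ?_
  obtain ⟨n, hn⟩ := exists_nat_one_div_lt hε
  obtain ⟨C, hC⟩ := hb
  have hn0 : (0 : ℝ) < n + 1 := by positivity
  -- `C` bounds `g`, so that the levels `k / (n + 1)` with `k > N` are never exceeded
  obtain ⟨N, hN⟩ := exists_nat_gt (C * (n + 1))
  let s : lp (fun _ : X => ℂ) ∞ :=
    ((n + 1 : ℂ)⁻¹) • ∑ k ∈ Finset.range N, chi {x | ((k : ℝ) + 1) / (n + 1) < g x}
  have hs : s ∈ B0 X := SMulMemClass.smul_mem _ (sum_mem fun k _ => chi_mem_B0 (hg _ (by positivity)))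
  refine ⟨s, hs, lt_of_le_of_lt ?_ hn⟩
  rw [dist_eq_norm]
  refine lp.norm_le_of_forall_le (by positivity) fun x => ?_
  have hgC : g x ≤ C := by
    have := hC x
    rw [Complex.norm_real, Real.norm_eq_abs] at this
    exact (le_abs_self _).trans this
  -- the sum counts the levels `k / (n + 1)`, `k ≥ 1`, strictly below `g x`, whence the ceiling minus
  -- one (truncated to `0` where `g x = 0`)
  have hcard : (∑ k ∈ Finset.range N, chi {x | ((k : ℝ) + 1) / (n + 1) < g x} :
      lp (fun _ : X => ℂ) ∞) x = ((⌈g x * (n + 1)⌉₊ - 1 : ℕ) : ℂ) := by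
    have h1 : ∀ k : ℕ, chi {x | ((k : ℝ) + 1) / (n + 1) < g x} x
        = if k < ⌈g x * (n + 1)⌉₊ - 1 then 1 else 0 := fun k => by
      have h2 : ((k : ℝ) + 1) / (n + 1) < g x ↔ k < ⌈g x * (n + 1)⌉₊ - 1 := by
        rw [div_lt_iff₀ hn0, Nat.lt_sub_iff_add_lt, Nat.lt_ceil]
        push_cast
        rfl
      by_cases hk : ((k : ℝ) + 1) / (n + 1) < g x
      · rw [if_pos (h2.1 hk), coe_chi, Set.indicator_of_mem (s := {x | ((k : ℝ) + 1) / (n + 1) < g x}) hk]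
      · rw [if_neg (mt h2.2 hk), coe_chi, Set.indicator_of_notMem (s := {x | ((k : ℝ) + 1) / (n + 1) < g x}) hk]
    rw [lp.coeFn_sum, Finset.sum_apply, Finset.sum_congr rfl fun k _ => h1 k, Finset.sum_boole]
    congr 1
    have h3 : ⌈g x * (n + 1)⌉₊ - 1 ≤ N := by
      refine (Nat.sub_le _ _).trans (Nat.ceil_le.2 (le_trans ?_ hN.le))
      gcongr
    rw [show Finset.filter (fun k => k < ⌈g x * (n + 1)⌉₊ - 1) (Finset.range N)
      = Finset.range (⌈g x * (n + 1)⌉₊ - 1) from ?_, Finset.card_range]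
    ext k
    simp only [Finset.mem_filter, Finset.mem_range]
    omega
  have hval : s x = (((⌈g x * (n + 1)⌉₊ - 1 : ℕ) : ℝ) / (n + 1) : ℝ) := by
    rw [lp.coeFn_smul, Pi.smul_apply, hcard, smul_eq_mul]
    push_cast
    rw [div_eq_inv_mul]
  rw [lp.coeFn_sub, Pi.sub_apply, hval, toBddFun_apply, ← Complex.ofReal_sub, Complex.norm_real,
    Real.norm_eq_abs, abs_le]
  have h4 := Nat.le_ceil (g x * ((n : ℝ) + 1))
  have h5 := Nat.ceil_lt_add_one (mul_nonneg (hg0 x) hn0.le)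
  have h6 : (⌈g x * ((n : ℝ) + 1)⌉₊ : ℝ) ≤ ((⌈g x * (n + 1)⌉₊ - 1 : ℕ) : ℝ) + 1 := by
    exact_mod_cast Nat.le_add_of_sub_le le_rfl
  have h7 : ((⌈g x * (n + 1)⌉₊ - 1 : ℕ) : ℝ) ≤ g x * (n + 1) := by
    rcases Nat.eq_zero_or_pos ⌈g x * ((n : ℝ) + 1)⌉₊ with h0 | h0
    · rw [h0]
      simpa using mul_nonneg (hg0 x) hn0.le
    · rw [Nat.cast_pred h0]
      linarith
  constructor
  · rw [neg_le, neg_sub, sub_le_iff_le_add, div_le_iff₀ hn0]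
    have : (1 / ((n : ℝ) + 1) + g x) * (n + 1) = 1 + g x * (n + 1) := by field_simp
    rw [this]
    linarith
  · rw [sub_le_iff_le_add, ← add_div, le_div_iff₀ hn0]
    linarith

theorem norm_zeroAtInfty_apply_le (h : C₀(X, ℂ)) (x : X) : ‖h x‖ ≤ ‖h‖ :=
  h.toBCF.norm_coe_le_norm x

theorem isCompact_le_norm (h : C₀(X, ℂ)) {t : ℝ} (ht : 0 < t) : IsCompact {x | t ≤ ‖h x‖} := by
  have hev : ∀ᶠ x in cocompact X, ‖h x‖ < t := by
    have := (zero_at_infty h).norm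
    rw [norm_zero] at this
    exact this.eventually (gt_mem_nhds ht)
  obtain ⟨K, hK, hKs⟩ := mem_cocompact.1 hev
  refine hK.of_isClosed_subset (isClosed_le continuous_const (map_continuous h).norm) fun x hx => ?_
  by_contra hxK
  exact not_lt.2 (show t ≤ ‖h x‖ from hx) (show ‖h x‖ < t from hKs hxK)

theorem setOf_lt_mem_precompactOpens [T2Space X] (h : C₀(X, ℂ)) {g : X → ℝ} (hg : Continuous g)
    (hgh : ∀ x, g x ≤ ‖h x‖) {t : ℝ} (ht : 0 < t) : {x | t < g x} ∈ precompactOpens X := by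
  refine ⟨isOpen_lt continuous_const hg, ?_⟩
  refine (isCompact_le_norm h ht).of_isClosed_subset isClosed_closure
    (closure_minimal (fun x hx => ?_) (isCompact_le_norm h ht).isClosed)
  exact (le_of_lt hx).trans (hgh x)

/-- The element of `ℓ^∞(X)` given by a function in `C₀(X)`. -/
noncomputable def ofC0 (h : C₀(X, ℂ)) : lp (fun _ : X => ℂ) ∞ := toBddFun h ⟨‖h‖, norm_zeroAtInfty_apply_le h⟩

theorem coe_ofC0 (h : C₀(X, ℂ)) : ⇑(ofC0 h) = h := rfl

theorem posPart_mem_B0 [T2Space X] (h : C₀(X, ℂ)) {g : X → ℝ} (hg : Continuous g)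
    (hgh : ∀ x, g x ≤ ‖h x‖) :
    ∃ f ∈ B0 X, ∀ x, f x = (max (g x) 0 : ℝ) := by
  have hle : ∀ x, max (g x) 0 ≤ ‖h x‖ := fun x => max_le (hgh x) (norm_nonneg _)
  have hb : ∃ C : ℝ, ∀ x, ‖((max (g x) 0 : ℝ) : ℂ)‖ ≤ C := ⟨‖h‖, fun x => by
    rw [Complex.norm_real, Real.norm_eq_abs, abs_of_nonneg (le_max_right _ _)]
    exact (hle x).trans (norm_zeroAtInfty_apply_le h x)⟩
  exact ⟨_, toBddFun_mem_B0 (fun x => le_max_right _ _)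
    (fun t ht => setOf_lt_mem_precompactOpens h (hg.max continuous_const) hle ht) hb, fun _ => rfl⟩

theorem ofC0_mem_B0 [T2Space X] (h : C₀(X, ℂ)) : ofC0 h ∈ B0 X := by
  have hc : Continuous h := map_continuous h
  have hre := Complex.continuous_re.comp hc
  have him := Complex.continuous_im.comp hc
  obtain ⟨f₁, h₁, e₁⟩ := posPart_mem_B0 h hre fun x => Complex.re_le_norm _
  obtain ⟨f₂, h₂, e₂⟩ := posPart_mem_B0 h hre.neg fun x =>
    (neg_le_abs _).trans (Complex.abs_re_le_norm _)
  obtain ⟨f₃, h₃, e₃⟩ := posPart_mem_B0 h him fun x => (le_abs_self _).trans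
    (Complex.abs_im_le_norm _)
  obtain ⟨f₄, h₄, e₄⟩ := posPart_mem_B0 h him.neg fun x =>
    (neg_le_abs _).trans (Complex.abs_im_le_norm _)
  have : ofC0 h = f₁ - f₂ + Complex.I • (f₃ - f₄) := by
    ext x
    have hmax : ∀ a : ℝ, max a 0 - max (-a) 0 = a := fun a => by
      rcases le_total a 0 with h | h <;> simp [h]
    have hre' := hmax (h x).re
    have him' := hmax (h x).im
    simp only [lp.coeFn_add, lp.coeFn_sub, lp.coeFn_smul, Pi.add_apply, Pi.sub_apply,
      Pi.smul_apply, e₁, e₂, e₃, e₄, ← Complex.ofReal_sub, Function.comp_apply, Pi.neg_apply, hre', him', coe_ofC0,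
      smul_eq_mul]
    rw [mul_comm, Complex.re_add_im]
  rw [this]
  exact add_mem (sub_mem h₁ h₂) (SMulMemClass.smul_mem _ (sub_mem h₃ h₄))

end B0

/-! ### Families of operator integrals with bounded total mass -/

theorem tendsto_norm_of_approx {E : Type*} [SeminormedAddCommGroup E] {u : Planck → E}
    (h : ∀ ε > 0, ∃ v : Planck → E, Tendsto (fun ħ => ‖v ħ‖) toZero (𝓝 0) ∧
      ∀ ħ, ‖u ħ - v ħ‖ ≤ ε) : Tendsto (fun ħ => ‖u ħ‖) toZero (𝓝 0) := by
  rw [NormedAddGroup.tendsto_nhds_zero]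
  intro ε hε
  obtain ⟨v, hv, huv⟩ := h (ε / 2) (half_pos hε)
  filter_upwards [hv.eventually (gt_mem_nhds (half_pos hε))] with ħ hħ
  rw [norm_norm]
  calc ‖u ħ‖ = ‖(u ħ - v ħ) + v ħ‖ := by rw [sub_add_cancel]
    _ ≤ ‖u ħ - v ħ‖ + ‖v ħ‖ := norm_add_le _ _
    _ < ε / 2 + ε / 2 := add_lt_add_of_le_of_lt (huv ħ) hħ
    _ = ε := add_halves ε

section Family

variable {X : Type*} [TopologicalSpace X] [MeasurableSpace X] [BorelSpace X]
  {H : Type*} [NormedAddCommGroup H] [InnerProductSpace ℂ H] [CompleteSpace H]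

theorem op_chi (A : POVM X H) {U : Set X} (hU : U ∈ precompactOpens X) : A.op (chi U) = A U := by
  rw [coe_chi, A.op_indicator hU.1.measurableSet, one_smul]

variable {f g : lp (fun _ : X => ℂ) ∞}

theorem op_add_B0 (A : POVM X H) (hf : f ∈ B0 X) (hg : g ∈ B0 X) :
    A.op ⇑(f + g) = A.op f + A.op g :=
  A.op_add (isBddMeas_of_mem_B0 hf) (isBddMeas_of_mem_B0 hg)

theorem op_sub_B0 (A : POVM X H) (hf : f ∈ B0 X) (hg : g ∈ B0 X) :
    A.op ⇑(f - g) = A.op f - A.op g :=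
  A.op_sub (isBddMeas_of_mem_B0 hf) (isBddMeas_of_mem_B0 hg)

theorem op_smul_B0 (A : POVM X H) (c : ℂ) (hf : f ∈ B0 X) : A.op ⇑(c • f) = c • A.op f :=
  A.op_const_mul c (isBddMeas_of_mem_B0 hf)

variable {A A' : Planck → POVM X H} {C : ℝ}

theorem norm_op_B0_le {A : POVM X H} (hC : ‖A Set.univ‖ ≤ C) (hf : f ∈ B0 X) :
    ‖A.op f‖ ≤ ‖f‖ * C :=
  (A.norm_op_le (isBddMeas_of_mem_B0 hf) (norm_nonneg f) (norm_bddFun_apply_le f)).trans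
    (mul_le_mul_of_nonneg_left hC (norm_nonneg f))

theorem continuous_op_B0 (hC0 : 0 < C) (hC : ∀ ħ, ‖A ħ Set.univ‖ ≤ C)
    (hA : ∀ U ∈ precompactOpens X, Continuous fun ħ => A ħ U) (hf : f ∈ B0 X) :
    Continuous fun ħ => (A ħ).op f := by
  refine B0_induction (P := fun f => Continuous fun ħ => (A ħ).op f) ?_ ?_ ?_ ?_ hf
  · intro U hU
    simpa only [op_chi _ hU] using hA U hU
  · intro f hf g hg hf' hg'
    simp only [op_add_B0 _ hf hg]
    exact hf'.add hg'
  · intro c f hf hf'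
    simp only [op_smul_B0 _ c hf]
    exact hf'.const_smul c
  · intro f hf h
    refine continuous_of_uniform_approx_of_continuous fun u hu => ?_
    obtain ⟨ε, hε, hu⟩ := Metric.mem_uniformity_dist.1 hu
    obtain ⟨g, hg, hg', hfg⟩ := h (ε / (2 * C)) (by positivity)
    refine ⟨_, hg', fun ħ => hu ?_⟩
    rw [dist_eq_norm, ← op_sub_B0 _ hf hg]
    calc _ ≤ ‖f - g‖ * C := norm_op_B0_le (hC ħ) (sub_mem hf hg)
      _ ≤ ε / (2 * C) * C := by gcongr
      _ = ε / 2 := by field_simp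
      _ < ε := half_lt_self hε

theorem tendsto_op_sub_op (hC0 : 0 < C) (hC : ∀ ħ, ‖A ħ Set.univ‖ ≤ C)
    (hC' : ∀ ħ, ‖A' ħ Set.univ‖ ≤ C)
    (h : ∀ U ∈ precompactOpens X, Tendsto (fun ħ => ‖A ħ U - A' ħ U‖) toZero (𝓝 0))
    (hf : f ∈ B0 X) : Tendsto (fun ħ => ‖(A ħ).op f - (A' ħ).op f‖) toZero (𝓝 0) := by
  refine B0_induction
    (P := fun f => Tendsto (fun ħ => ‖(A ħ).op f - (A' ħ).op f‖) toZero (𝓝 0)) ?_ ?_ ?_ ?_ hf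
  · intro U hU
    simpa only [op_chi _ hU] using h U hU
  · intro f hf g hg hf' hg'
    simp only [op_add_B0 _ hf hg, add_sub_add_comm]
    exact squeeze_zero (fun _ => norm_nonneg _) (fun _ => norm_add_le _ _)
      (by simpa using hf'.add hg')
  · intro c f hf hf'
    simp only [op_smul_B0 _ c hf, ← smul_sub, norm_smul]
    simpa using hf'.const_mul ‖c‖
  · intro f hf h
    refine tendsto_norm_of_approx fun ε hε => ?_
    obtain ⟨g, hg, hg', hfg⟩ := h (ε / (2 * C)) (by positivity)
    refine ⟨_, hg', fun ħ => ?_⟩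
    rw [sub_sub_sub_comm, ← op_sub_B0 _ hf hg, ← op_sub_B0 _ hf hg]
    have h1 := norm_op_B0_le (hC ħ) (sub_mem hf hg)
    have h2 := norm_op_B0_le (hC' ħ) (sub_mem hf hg)
    calc _ ≤ ‖f - g‖ * C + ‖f - g‖ * C := (norm_sub_le _ _).trans (add_le_add h1 h2)
      _ ≤ ε / (2 * C) * C + ε / (2 * C) * C := by gcongr
      _ = ε := by field_simp; norm_num

/-- The failure of `f ↦ ∫ f dA` to be multiplicative. -/
noncomputable def mulDefect (A : POVM X H) (f g : lp (fun _ : X => ℂ) ∞) : H →L[ℂ] H :=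
  A.op ⇑(f * g) - A.op f * A.op g

theorem mulDefect_add_left (A : POVM X H) {f f' g : lp (fun _ : X => ℂ) ∞} (hf : f ∈ B0 X)
    (hf' : f' ∈ B0 X) (hg : g ∈ B0 X) :
    mulDefect A (f + f') g = mulDefect A f g + mulDefect A f' g := by
  rw [mulDefect, add_mul, op_add_B0 _ (mul_mem hf hg) (mul_mem hf' hg), op_add_B0 _ hf hf', add_mul,
    add_sub_add_comm]
  rfl

theorem mulDefect_add_right (A : POVM X H) {f g g' : lp (fun _ : X => ℂ) ∞} (hf : f ∈ B0 X)
    (hg : g ∈ B0 X) (hg' : g' ∈ B0 X) :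
    mulDefect A f (g + g') = mulDefect A f g + mulDefect A f g' := by
  rw [mulDefect, mul_add, op_add_B0 _ (mul_mem hf hg) (mul_mem hf hg'), op_add_B0 _ hg hg', mul_add,
    add_sub_add_comm]
  rfl

theorem mulDefect_smul_left (A : POVM X H) (c : ℂ) (hf : f ∈ B0 X) (hg : g ∈ B0 X) :
    mulDefect A (c • f) g = c • mulDefect A f g := by
  rw [mulDefect, smul_mul_assoc, op_smul_B0 _ _ (mul_mem hf hg), op_smul_B0 _ _ hf, smul_mul_assoc,
    ← smul_sub]
  rfl

theorem mulDefect_smul_right (A : POVM X H) (c : ℂ) (hf : f ∈ B0 X) (hg : g ∈ B0 X) :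
    mulDefect A f (c • g) = c • mulDefect A f g := by
  rw [mulDefect, mul_smul_comm, op_smul_B0 _ _ (mul_mem hf hg), op_smul_B0 _ _ hg, mul_smul_comm,
    ← smul_sub]
  rfl

theorem norm_mulDefect_le {A : POVM X H} (hC0 : 0 < C) (hC : ‖A Set.univ‖ ≤ C) (hf : f ∈ B0 X)
    (hg : g ∈ B0 X) : ‖mulDefect A f g‖ ≤ ‖f‖ * ‖g‖ * (C + C ^ 2) := by
  have h1 := norm_op_B0_le hC (mul_mem hf hg)
  have h2 := norm_op_B0_le hC hf
  have h3 := norm_op_B0_le hC hg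
  calc ‖mulDefect A f g‖ ≤ ‖A.op ⇑(f * g)‖ + ‖A.op f * A.op g‖ := norm_sub_le _ _
    _ ≤ ‖f‖ * ‖g‖ * C + (‖f‖ * C) * (‖g‖ * C) := by
      refine add_le_add (h1.trans ?_) ((norm_mul_le _ _).trans ?_)
      · gcongr
        exact norm_mul_le f g
      · gcongr
    _ = _ := by ring

theorem tendsto_mulDefect (hC0 : 0 < C) (hC : ∀ ħ, ‖A ħ Set.univ‖ ≤ C)
    (h : ∀ U ∈ precompactOpens X, ∀ V ∈ precompactOpens X,
      Tendsto (fun ħ => ‖A ħ (U ∩ V) - A ħ U * A ħ V‖) toZero (𝓝 0))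
    (hf : f ∈ B0 X) (hg : g ∈ B0 X) :
    Tendsto (fun ħ => ‖mulDefect (A ħ) f g‖) toZero (𝓝 0) := by
  have hD : 0 < C + C ^ 2 := by positivity
  refine B0_induction (P := fun f => Tendsto (fun ħ => ‖mulDefect (A ħ) f g‖) toZero (𝓝 0))
    (fun U hU => ?_) ?_ ?_ ?_ hf
  · refine B0_induction
      (P := fun g => Tendsto (fun ħ => ‖mulDefect (A ħ) (chi U) g‖) toZero (𝓝 0)) ?_ ?_ ?_ ?_ hg
    · intro V hV
      simpa only [mulDefect, chi_mul_chi, op_chi _ hU, op_chi _ hV,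
        op_chi _ (inter_mem_precompactOpens hU hV)] using h U hU V hV
    · intro g hg g' hg' h1 h2
      simp only [mulDefect_add_right _ (chi_mem_B0 hU) hg hg']
      exact squeeze_zero (fun _ => norm_nonneg _) (fun _ => norm_add_le _ _)
        (by simpa using h1.add h2)
    · intro c g hg h1
      simp only [mulDefect_smul_right _ c (chi_mem_B0 hU) hg, norm_smul]
      simpa using h1.const_mul ‖c‖
    · intro g hg h
      refine tendsto_norm_of_approx fun ε hε => ?_
      obtain ⟨k, hk, hk', hgk⟩ := h (ε / ((‖chi U‖ + 1) * (C + C ^ 2))) (by positivity)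
      refine ⟨_, hk', fun ħ => ?_⟩
      have hs := mulDefect_add_right (A ħ) (chi_mem_B0 hU) (sub_mem hg hk) hk
      rw [sub_add_cancel] at hs
      rw [hs, add_sub_cancel_right]
      calc _ ≤ ‖chi U‖ * ‖g - k‖ * (C + C ^ 2) :=
            norm_mulDefect_le hC0 (hC ħ) (chi_mem_B0 hU) (sub_mem hg hk)
        _ ≤ (‖chi U‖ + 1) * (ε / ((‖chi U‖ + 1) * (C + C ^ 2))) * (C + C ^ 2) := by
            gcongr
            linarith
        _ = ε := by field_simp
  · intro f hf f' hf' h1 h2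
    simp only [mulDefect_add_left _ hf hf' hg]
    exact squeeze_zero (fun _ => norm_nonneg _) (fun _ => norm_add_le _ _)
      (by simpa using h1.add h2)
  · intro c f hf h1
    simp only [mulDefect_smul_left _ c hf hg, norm_smul]
    simpa using h1.const_mul ‖c‖
  · intro f hf h
    refine tendsto_norm_of_approx fun ε hε => ?_
    obtain ⟨k, hk, hk', hfk⟩ := h (ε / ((‖g‖ + 1) * (C + C ^ 2))) (by positivity)
    refine ⟨_, hk', fun ħ => ?_⟩
    have hs := mulDefect_add_left (A ħ) (sub_mem hf hk) hk hg
    rw [sub_add_cancel] at hs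
    rw [hs, add_sub_cancel_right]
    calc _ ≤ ‖f - k‖ * ‖g‖ * (C + C ^ 2) :=
          norm_mulDefect_le hC0 (hC ħ) (sub_mem hf hk) hg
      _ ≤ ε / ((‖g‖ + 1) * (C + C ^ 2)) * (‖g‖ + 1) * (C + C ^ 2) := by
          gcongr
          linarith
      _ = ε := by field_simp

end Family

/-! ### Truncation of the parameter -/

section Truncation

theorem eventually_le_toZero (δ : Planck) : ∀ᶠ ħ in toZero, ħ ≤ δ := by
  have : ∀ᶠ t in 𝓝 (0 : ℝ), t ≤ (δ : ℝ) := eventually_le_nhds δ.2.1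
  exact this.comap _

theorem exists_forall_le_of_eventually {p : Planck → Prop} (h : ∀ᶠ ħ in toZero, p ħ) :
    ∃ δ : Planck, ∀ ħ ≤ δ, p ħ := by
  obtain ⟨ε, hε, h⟩ := Metric.eventually_nhds_iff.1 (eventually_comap.1 h)
  refine ⟨⟨min 1 (ε / 2), lt_min one_pos (half_pos hε), min_le_left _ _⟩, fun ħ hħ => ?_⟩
  refine h (y := (ħ : ℝ)) ?_ ħ rfl
  rw [dist_zero_right, Real.norm_of_nonneg ħ.2.1.le]
  exact ((show (ħ : ℝ) ≤ min 1 (ε / 2) from hħ).trans (min_le_right _ _)).trans_lt (half_lt_self hε)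

/-- Replacing `ħ` by `min ħ δ` for a suitable `δ` makes the total masses bounded and changes nothing
for small `ħ`; no truncation is needed if the total masses are bounded already. -/
theorem ASM.exists_truncation {X : Type*} [MeasurableSpace X] {H : Type*} [NormedAddCommGroup H]
    [InnerProductSpace ℂ H] [CompleteSpace H] {𝓔 : Set (Set X)} (A : ASM X H 𝓔) :
    ∃ c : Planck → Planck, Continuous c ∧ (∀ᶠ ħ in toZero, c ħ = ħ) ∧
      (A.UniformlyBounded → ∀ ħ, c ħ = ħ) ∧ ∃ C : ℝ, 0 < C ∧
      ∀ ħ, ‖A.toPOVM (c ħ) Set.univ‖ ≤ C := by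
  by_cases hA : A.UniformlyBounded
  · obtain ⟨C, hC⟩ := hA
    exact ⟨id, continuous_id, Eventually.of_forall fun _ => rfl, fun _ _ => rfl, max C 1,
      lt_max_of_lt_right one_pos, fun ħ => (hC ħ).trans (le_max_left _ _)⟩
  · have hev : ∀ᶠ ħ in toZero, ‖A.toPOVM ħ Set.univ‖ₑ < 2 :=
      eventually_lt_of_limsup_lt (A.limsup_le.trans_lt (by norm_num))
    obtain ⟨δ, hδ⟩ := exists_forall_le_of_eventually hev
    refine ⟨fun ħ => min ħ δ, continuous_id.min continuous_const, ?_, fun h => absurd h hA, 2,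
      two_pos, fun ħ => ?_⟩
    · filter_upwards [eventually_le_toZero δ] with ħ hħ using min_eq_left hħ
    · have := (hδ _ (min_le_right ħ δ)).le
      rwa [← ofReal_norm, ENNReal.ofReal_le_iff_le_toReal (by norm_num), ENNReal.toReal_ofNat] at this

end Truncation

/-! ### Integrals with values in a hereditary subalgebra -/

section Hereditary

variable {X : Type*} [TopologicalSpace X] [MeasurableSpace X] [BorelSpace X]
  {H : Type*} [NormedAddCommGroup H] [InnerProductSpace ℂ H] [CompleteSpace H]
  {B : NonUnitalStarSubalgebra ℂ (H →L[ℂ] H)}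

omit [TopologicalSpace X] [BorelSpace X] in
theorem op_ofReal_mem_of_support (hB : IsHereditary B) {A : POVM X H} {U : Set X}
    (hU : MeasurableSet U) (hA : A U ∈ B) {g : X → ℝ} (hg : Measurable g) (hg0 : ∀ x, 0 ≤ g x)
    {C : ℝ} (hC : ∀ x, g x ≤ C) (hs : ∀ x ∉ U, g x = 0) : A.op (fun x => (g x : ℂ)) ∈ B := by
  have hf : IsBddMeas (fun x => (g x : ℂ)) := ⟨Complex.measurable_ofReal.comp hg, C, fun x => by
    rw [Complex.norm_real, Real.norm_of_nonneg (hg0 x)]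
    exact hC x⟩
  refine hB ((C : ℂ) • A U) (SMulMemClass.smul_mem _ hA) _
    (A.op_nonneg hf fun x => by exact_mod_cast hg0 x) ?_
  rw [← A.op_indicator hU]
  refine A.op_mono hf (IsBddMeas.indicator_const hU _) fun x => ?_
  by_cases hx : x ∈ U
  · rw [Set.indicator_of_mem hx]
    exact_mod_cast hC x
  · rw [Set.indicator_of_notMem hx, hs x hx, Complex.ofReal_zero]

omit [TopologicalSpace X] [BorelSpace X] in
theorem op_mem_of_support (hB : IsHereditary B) {A : POVM X H} {U : Set X}
    (hU : MeasurableSet U) (hA : A U ∈ B) {f : X → ℂ} (hf : IsBddMeas f)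
    (hs : ∀ x ∉ U, f x = 0) : A.op f ∈ B := by
  obtain ⟨C, hC⟩ := hf.bdd
  have key : ∀ g : X → ℝ, Measurable g → (∀ x, |g x| ≤ ‖f x‖) →
      IsBddMeas (fun x => (g x : ℂ)) ∧ A.op (fun x => (g x : ℂ)) ∈ B := fun g hg hgf => by
    have h0 : ∀ x ∉ U, g x = 0 := fun x hx => by
      have := hgf x
      rw [hs x hx, norm_zero] at this
      exact abs_nonpos_iff.1 this
    have hpos : ∀ g' : X → ℝ, Measurable g' → (∀ x, |g' x| = |g x|) →
        IsBddMeas (fun x => ((max (g' x) 0 : ℝ) : ℂ)) ∧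
        A.op (fun x => ((max (g' x) 0 : ℝ) : ℂ)) ∈ B := fun g' hg' h' => by
      have hle : ∀ x, max (g' x) 0 ≤ C := fun x =>
        (max_le ((le_abs_self _).trans ((h' x).le.trans (hgf x))) (norm_nonneg _)).trans (hC x)
      refine ⟨⟨Complex.measurable_ofReal.comp (hg'.max measurable_const), C, fun x => ?_⟩,
        op_ofReal_mem_of_support hB hU hA (hg'.max measurable_const)
          (fun x => le_max_right _ _) hle fun x hx => ?_⟩
      · rw [Complex.norm_real, Real.norm_of_nonneg (le_max_right _ _)]
        exact hle x
      · have : g' x = 0 := by rw [← abs_eq_zero, h' x, h0 x hx, abs_zero]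
        simp [this]
    obtain ⟨m₁, h₁⟩ := hpos g hg fun _ => rfl
    obtain ⟨m₂, h₂⟩ := hpos (fun x => -g x) hg.neg fun _ => abs_neg _
    have : (fun x => (g x : ℂ))
        = fun x => ((max (g x) 0 : ℝ) : ℂ) - ((max (-g x) 0 : ℝ) : ℂ) := by
      ext x
      rw [← Complex.ofReal_sub]
      congr 1
      rcases le_total (g x) 0 with h | h <;> simp [h]
    rw [this, A.op_sub m₁ m₂]
    exact ⟨m₁.sub m₂, sub_mem h₁ h₂⟩
  obtain ⟨m₁, h₁⟩ := key (fun x => (f x).re) (Complex.measurable_re.comp hf.measurable)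
    fun x => Complex.abs_re_le_norm _
  obtain ⟨m₂, h₂⟩ := key (fun x => (f x).im) (Complex.measurable_im.comp hf.measurable)
    fun x => Complex.abs_im_le_norm _
  have : f = fun x => ((f x).re : ℂ) + Complex.I * ((f x).im : ℂ) := by
    ext x
    rw [mul_comm, Complex.re_add_im]
  rw [this, A.op_add m₁ (m₂.const_mul _), A.op_const_mul _ m₂]
  exact add_mem h₁ (SMulMemClass.smul_mem _ h₂)

theorem isBddMeas_C0 (h : C₀(X, ℂ)) : IsBddMeas h :=
  ⟨(map_continuous h).measurable, ‖h‖, norm_zeroAtInfty_apply_le h⟩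

theorem op_C0_mem_topologicalClosure [T2Space X] (hB : IsHereditary B) {A : POVM X H}
    (hA : ∀ U ∈ precompactOpens X, A U ∈ B) (h : C₀(X, ℂ)) : A.op h ∈ B.topologicalClosure := by
  refine Metric.mem_closure_iff.2 fun ε hε => ?_
  have hD : 0 < ‖A Set.univ‖ + 1 := by positivity
  set δ := ε / (‖A Set.univ‖ + 1) with hδ
  have hδ0 : 0 < δ := by positivity
  set U := {x | δ < ‖h x‖}
  have hU : U ∈ precompactOpens X :=
    setOf_lt_mem_precompactOpens h (map_continuous h).norm (fun _ => le_rfl) hδ0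
  have hUm := hU.1.measurableSet
  have hh := isBddMeas_C0 h
  refine ⟨A.op (U.indicator h), op_mem_of_support hB hUm (hA U hU) (hh.indicator hUm)
    fun x hx => Set.indicator_of_notMem hx _, ?_⟩
  rw [dist_eq_norm, ← A.op_sub hh (hh.indicator hUm)]
  refine (A.norm_op_le (hh.sub (hh.indicator hUm)) hδ0.le fun x => ?_).trans_lt ?_
  · by_cases hx : x ∈ U
    · simpa [Set.indicator_of_mem hx] using hδ0.le
    · rw [Set.indicator_of_notMem hx, sub_zero]
      exact not_lt.1 hx
  · calc δ * ‖A Set.univ‖ < δ * (‖A Set.univ‖ + 1) := by gcongr; linarith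
      _ = ε := by rw [hδ]; field_simp

theorem op_mem_of_hasCompactSupport (hB : IsHereditary B) {A : POVM X H}
    (hA : ∀ U ∈ precompactOpens X, A U ∈ B) (h : C₀(X, ℂ)) (hs : HasCompactSupport h) :
    A.op h ∈ B := by
  -- the closure of this open set is the topological support of `h`
  have hU : Function.support h ∈ precompactOpens X :=
    ⟨(map_continuous h).isOpen_support, hs⟩
  exact op_mem_of_support hB hU.1.measurableSet (hA _ hU) (isBddMeas_C0 h)
    fun x hx => Function.notMem_support.1 hx

end Hereditary

/-! ### Complete positivity -/

section CompletelyPositive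

/-- `CStarAlgebra.nonneg_iff_eq_star_mul_self` with the functional calculus synthesized from the
C*-algebra structure, so that it also applies to `CStarMatrix` over a non-unital algebra. -/
theorem exists_eq_star_mul_self {E : Type*} [NonUnitalCStarAlgebra E] [PartialOrder E]
    [StarOrderedRing E] {a : E} (ha : 0 ≤ a) : ∃ b, a = star b * b :=
  CStarAlgebra.nonneg_iff_eq_star_mul_self.1 ha

/-- A positive element of a closed `*`-subalgebra is of the form `b* b` with `b` in the subalgebra,
namely with `b` its square root. -/
theorem exists_mem_eq_star_mul_self {E : Type*} [NonUnitalCStarAlgebra E] [PartialOrder E]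
    [StarOrderedRing E] (T : NonUnitalStarSubalgebra ℂ E) [hT : IsClosed (T : Set E)] {a : E}
    (ha : 0 ≤ a) (haT : a ∈ T) : ∃ b ∈ T, a = star b * b := by
  refine ⟨CFC.sqrt a, ?_, ?_⟩
  · rw [CFC.sqrt_eq_real_sqrt _ ha]
    exact cfcₙ_mem (𝕜 := ℝ) (s := T) Real.sqrt haT
  · rw [(CFC.sqrt_nonneg a).isSelfAdjoint.star_eq, CFC.sqrt_mul_sqrt_self _ ha]

/-- A matrix over a closed `*`-subalgebra is positive if it is positive over the ambient algebra:
its square root has entries in the subalgebra as well. -/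
theorem cstarMatrix_nonneg_of_map_coe {A : Type*} [NonUnitalCStarAlgebra A] [PartialOrder A]
    [StarOrderedRing A] (S : NonUnitalStarSubalgebra ℂ A) [hS : IsClosed (S : Set A)] {n : Type*}
    [Fintype n] (M : CStarMatrix n n S) (hM : 0 ≤ M.map ((↑) : S → A)) : 0 ≤ M := by
  let T : NonUnitalStarSubalgebra ℂ (CStarMatrix n n A) :=
    { carrier := {N | ∀ i j, N i j ∈ S}
      add_mem' := fun hN hN' i j => add_mem (hN i j) (hN' i j)
      zero_mem' := fun i j => zero_mem S
      mul_mem' := fun {N N'} hN hN' i j => by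
        rw [CStarMatrix.mul_apply]
        exact sum_mem fun k _ => mul_mem (hN i k) (hN' k j)
      smul_mem' := fun c N hN i j => SMulMemClass.smul_mem c (hN i j)
      star_mem' := fun hN i j => star_mem (hN j i) }
  have hT : IsClosed (T : Set (CStarMatrix n n A)) := by
    have : (T : Set (CStarMatrix n n A)) = ⋂ i, ⋂ j, (fun N : CStarMatrix n n A => N i j) ⁻¹' S := by
      ext N
      simp only [Set.mem_iInter]
      rfl
    rw [this]
    exact isClosed_iInter fun i => isClosed_iInter fun j =>
      hS.preimage (continuous_apply_apply i j)
  obtain ⟨R, hR, hMR⟩ := exists_mem_eq_star_mul_self T hM fun i j => (M i j).2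
  let N : CStarMatrix n n S := fun i j => ⟨R i j, hR i j⟩
  have hN : M = star N * N := by
    ext i j
    have h := congrArg (fun K : CStarMatrix n n A => K i j) hMR
    simp only [CStarMatrix.mul_apply, CStarMatrix.map_apply] at h
    rw [h, CStarMatrix.mul_apply]
    push_cast
    rfl
  rw [hN]
  exact star_mul_self_nonneg N

variable {X : Type*} [MeasurableSpace X]
  {H : Type*} [NormedAddCommGroup H] [InnerProductSpace ℂ H] [CompleteSpace H]

/-- A bounded measurable function into a proper space is a uniform limit of simple functions. -/
theorem exists_simpleFunc_uniform_approx {E : Type*} [NormedAddCommGroup E] [ProperSpace E]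
    [SecondCountableTopology E] [MeasurableSpace E] [BorelSpace E] {F : X → E} (hF : Measurable F)
    {K : ℝ} (hK : ∀ x, ‖F x‖ ≤ K) {ε : ℝ} (hε : 0 < ε) :
    ∃ S : SimpleFunc X E, ∀ x, ‖F x - S x‖ ≤ ε := by
  obtain ⟨N, hN⟩ := (isCompact_closedBall (0 : E) K).elim_directed_cover
    (fun N : ℕ => ⋃ k ∈ Finset.range (N + 1), Metric.ball (TopologicalSpace.denseSeq E k) ε)
    (fun N => isOpen_biUnion fun _ _ => Metric.isOpen_ball)
    (fun y _ => by
      obtain ⟨k, hk⟩ := (TopologicalSpace.denseRange_denseSeq E).exists_dist_lt y hε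
      exact Set.mem_iUnion.2 ⟨k, Set.mem_biUnion (Finset.self_mem_range_succ k) hk⟩)
    (Monotone.directed_le fun N N' h => Set.biUnion_mono (fun k hk => by
      simp only [Finset.coe_range, Set.mem_Iio] at hk ⊢
      omega) fun _ _ => le_rfl)
  refine ⟨(SimpleFunc.nearestPt (TopologicalSpace.denseSeq E) N).comp F hF, fun x => ?_⟩
  have hx : F x ∈ Metric.closedBall (0 : E) K := by simpa using hK x
  obtain ⟨k, hk, hxk⟩ := Set.mem_iUnion₂.1 (hN hx)
  have h := SimpleFunc.edist_nearestPt_le (TopologicalSpace.denseSeq E) (F x)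
    (Nat.lt_succ_iff.1 (Finset.mem_range.1 hk))
  rw [edist_dist, edist_dist, ENNReal.ofReal_le_ofReal_iff dist_nonneg] at h
  rw [SimpleFunc.coe_comp, Function.comp_apply, ← dist_eq_norm, dist_comm]
  refine h.trans ?_
  rw [dist_comm]
  exact (Metric.mem_ball.1 hxk).le

/-- The operator matrix `∫ F(x)* F(x) dA(x)` of a matrix-valued function `F`, with entries
`∫ ∑ₗ conj (Fₗᵢ) Fₗⱼ dA`. -/
noncomputable def gram (A : POVM X H) {n : Type*} [Fintype n] (F : X → n → n → ℂ) :
    CStarMatrix n n (H →L[ℂ] H) :=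
  CStarMatrix.ofMatrix fun i j => A.op fun x => ∑ l, star (F x l i) * F x l j

theorem gram_simpleFunc_nonneg (A : POVM X H) {n : Type*} [Fintype n]
    (S : SimpleFunc X (n → n → ℂ)) : 0 ≤ gram A S := by
  -- split `X` into the sets on which `S` is constant
  have hdec : gram A S = ∑ c ∈ S.range, CStarMatrix.ofMatrix
      fun i j => (∑ l, star (c l i) * c l j) • A (S ⁻¹' {c}) := by
    refine CStarMatrix.ext fun i j => ?_
    have hsum : (∑ c ∈ S.range, CStarMatrix.ofMatrix
        fun i j => (∑ l, star (c l i) * c l j) • A (S ⁻¹' {c})) i j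
        = ∑ c ∈ S.range, (∑ l, star (c l i) * c l j) • A (S ⁻¹' {c}) :=
      Matrix.sum_apply i j S.range _
    rw [hsum]
    have h1 : (fun x => ∑ l, star (S x l i) * S x l j)
        = fun x => ∑ c ∈ S.range,
          (S ⁻¹' {c}).indicator (fun _ => ∑ l, star (c l i) * c l j) x := by
      ext x
      rw [Finset.sum_eq_single (S x)]
      · rw [Set.indicator_of_mem (by simp)]
      · intro c _ hc
        rw [Set.indicator_of_notMem (by simpa using hc.symm)]
      · intro hx
        exact absurd (S.mem_range_self x) hx
    change A.op _ = _
    rw [h1, A.op_sum _ fun c _ => IsBddMeas.indicator_const (S.measurableSet_fiber c) _]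
    exact Finset.sum_congr rfl fun c _ => A.op_indicator (S.measurableSet_fiber c) _
  rw [hdec]
  refine Finset.sum_nonneg fun c _ => ?_
  obtain ⟨R, hR⟩ := CStarAlgebra.nonneg_iff_eq_star_mul_self.1 (A.nonneg (S ⁻¹' {c}))
  let D : CStarMatrix n n (H →L[ℂ] H) := CStarMatrix.ofMatrix fun l j => c l j • R
  have hD : CStarMatrix.ofMatrix (fun i j => (∑ l, star (c l i) * c l j) • A (S ⁻¹' {c}))
      = star D * D := by
    refine CStarMatrix.ext fun i j => ?_
    rw [CStarMatrix.mul_apply]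
    change (∑ l, star (c l i) * c l j) • A (S ⁻¹' {c}) = ∑ l, star (c l i • R) * (c l j • R)
    rw [hR, Finset.sum_smul]
    refine Finset.sum_congr rfl fun l _ => ?_
    rw [star_smul, smul_mul_smul_comm]
  rw [hD]
  exact star_mul_self_nonneg D

theorem gram_nonneg (A : POVM X H) {n : Type*} [Fintype n] {F : X → n → n → ℂ}
    (hF : ∀ i j, IsBddMeas fun x => F x i j) : 0 ≤ gram A F := by
  have hFm : Measurable F :=
    measurable_pi_lambda _ fun i => measurable_pi_lambda _ fun j => (hF i j).measurable
  choose K hK using fun i j => (hF i j).bdd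
  obtain ⟨K', hK'⟩ : ∃ K', ∀ x, ‖F x‖ ≤ K' := by
    refine ⟨∑ i, ∑ j, |K i j|, fun x => ?_⟩
    have h0 : ∀ i, 0 ≤ ∑ j, |K i j| := fun i => Finset.sum_nonneg fun j _ => abs_nonneg _
    refine (pi_norm_le_iff_of_nonneg (Finset.sum_nonneg fun i _ => h0 i)).2 fun i => ?_
    refine le_trans ?_ (Finset.single_le_sum (fun i _ => h0 i) (Finset.mem_univ i))
    refine (pi_norm_le_iff_of_nonneg (h0 i)).2 fun j => ?_
    refine le_trans ((hK i j x).trans (le_abs_self _)) ?_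
    exact Finset.single_le_sum (f := fun j => |K i j|) (fun j _ => abs_nonneg _) (Finset.mem_univ j)
  choose S hS using fun m : ℕ => exists_simpleFunc_uniform_approx hFm hK'
    (Nat.one_div_pos_of_nat (α := ℝ) (n := m))
  have hSb : ∀ m i j, IsBddMeas fun x => S m x i j := fun m i j => by
    obtain ⟨C, hC⟩ := (S m).exists_forall_norm_le
    exact ⟨(measurable_pi_apply j).comp ((measurable_pi_apply i).comp (S m).measurable), C,
      fun x => (norm_le_pi_norm _ j).trans ((norm_le_pi_norm _ i).trans (hC x))⟩
  have hlim : Tendsto (fun m => gram A (S m)) atTop (𝓝 (gram A F)) := by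
    refine tendsto_pi_nhds.2 fun i => tendsto_pi_nhds.2 fun j => ?_
    change Tendsto (fun m => A.op fun x => ∑ l, star (S m x l i) * S m x l j) atTop
      (𝓝 (A.op fun x => ∑ l, star (F x l i) * F x l j))
    have e1 : ∀ m, (A.op fun x => ∑ l, star (S m x l i) * S m x l j)
        = ∑ l, A.op fun x => star (S m x l i) * S m x l j := fun m =>
      A.op_sum _ fun l _ => (hSb m l i).star.mul (hSb m l j)
    simp only [e1]
    rw [A.op_sum _ fun l _ => (hF l i).star.mul (hF l j)]
    refine tendsto_finsetSum _ fun l _ => ?_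
    rw [tendsto_iff_norm_sub_tendsto_zero]
    have hb : Tendsto (fun m : ℕ => 1 / ((m : ℝ) + 1) * (2 * |K'| + 1) * ‖A Set.univ‖) atTop
        (𝓝 0) := by
      simpa using ((tendsto_one_div_add_atTop_nhds_zero_nat (𝕜 := ℝ)).mul_const
        (2 * |K'| + 1)).mul_const ‖A Set.univ‖
    refine squeeze_zero (fun _ => norm_nonneg _) (fun m => ?_) hb
    rw [← A.op_sub ((hSb m l i).star.mul (hSb m l j)) ((hF l i).star.mul (hF l j))]
    refine A.norm_op_le (((hSb m l i).star.mul (hSb m l j)).sub ((hF l i).star.mul (hF l j)))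
      (by positivity) fun x => ?_
    have hent : ∀ p q, ‖S m x p q - F x p q‖ ≤ 1 / ((m : ℝ) + 1) := fun p q => by
      rw [norm_sub_rev]
      exact (norm_le_pi_norm (F x p - S m x p) q).trans
        ((norm_le_pi_norm (F x - S m x) p).trans (hS m x))
    have hFK : ∀ p q, ‖F x p q‖ ≤ |K'| := fun p q => (norm_le_pi_norm _ q).trans
      ((norm_le_pi_norm _ p).trans ((hK' x).trans (le_abs_self _)))
    have hm1 : 1 / ((m : ℝ) + 1) ≤ 1 := by
      rw [div_le_one (by positivity)]
      linarith [(Nat.cast_nonneg m : (0 : ℝ) ≤ m)]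
    have hSK : ‖S m x l j‖ ≤ |K'| + 1 := by
      calc ‖S m x l j‖ = ‖F x l j + (S m x l j - F x l j)‖ := by rw [add_sub_cancel]
        _ ≤ |K'| + 1 := (norm_add_le _ _).trans (add_le_add (hFK l j) ((hent l j).trans hm1))
    have e2 : star (S m x l i) * S m x l j - star (F x l i) * F x l j
        = star (S m x l i - F x l i) * S m x l j + star (F x l i) * (S m x l j - F x l j) := by
      rw [star_sub]
      ring
    rw [e2]
    calc _ ≤ ‖S m x l i - F x l i‖ * ‖S m x l j‖ + ‖F x l i‖ * ‖S m x l j - F x l j‖ := by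
          refine (norm_add_le _ _).trans_eq ?_
          rw [norm_mul, norm_mul, norm_star, norm_star]
      _ ≤ 1 / ((m : ℝ) + 1) * (|K'| + 1) + |K'| * (1 / ((m : ℝ) + 1)) := by
          gcongr
          · exact hent l i
          · exact hFK l i
          · exact hent l j
      _ = _ := by ring
  exact ge_of_tendsto' hlim fun m => gram_simpleFunc_nonneg A (S m)

end CompletelyPositive

/-! ### The asymptotic morphisms of an asymptotic spectral measure -/

section Morphisms

variable {X : Type*} [TopologicalSpace X] [MeasurableSpace X] [BorelSpace X]
  {H : Type*} [NormedAddCommGroup H] [InnerProductSpace ℂ H] [CompleteSpace H]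
  {B : NonUnitalStarSubalgebra ℂ (H →L[ℂ] H)}

omit [MeasurableSpace X] [BorelSpace X] in
theorem coe_add_B0 (f g : B0 X) : ((f + g : B0 X) : lp (fun _ : X => ℂ) ∞) = f + g := rfl

omit [MeasurableSpace X] [BorelSpace X] in
theorem coe_mul_B0 (f g : B0 X) : ((f * g : B0 X) : lp (fun _ : X => ℂ) ∞) = f * g := rfl

/-- The linear map `f ↦ ∫ f dA` on `B₀(X)`. -/
noncomputable def linearOp (A : POVM X H) : B0 X →ₗ[ℂ] (H →L[ℂ] H) where
  toFun f := A.op (f : lp (fun _ : X => ℂ) ∞)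
  map_add' f g := by rw [coe_add_B0, op_add_B0 A f.2 g.2]
  map_smul' c f := op_smul_B0 A c f.2

/-- The positive linear map `f ↦ ∫ f dA` on `B₀(X)`. -/
noncomputable def posOp (A : POVM X H) : B0 X →ₚ[ℂ] (H →L[ℂ] H) :=
  { linearOp A with
    monotone' := fun f g h => A.op_mono (isBddMeas_of_mem_B0 f.2) (isBddMeas_of_mem_B0 g.2)
      (apply_le_of_le (f := (f : lp (fun _ : X => ℂ) ∞)) h) }

theorem posOp_apply (A : POVM X H) (f : B0 X) :
    posOp A f = A.op (f : lp (fun _ : X => ℂ) ∞) := rfl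

theorem posOp_mul_sub (A : POVM X H) (f g : B0 X) :
    posOp A (f * g) - posOp A f * posOp A g = mulDefect A (f : lp (fun _ : X => ℂ) ∞) g := by
  rw [posOp_apply, posOp_apply, posOp_apply, coe_mul_B0]
  rfl

/-- The completely positive linear map `h ↦ ∫ h dA` on `C₀(X)`. -/
noncomputable def cpOp [T2Space X] (hB : IsHereditary B) (A : POVM X H)
    (hA : ∀ U ∈ precompactOpens X, A U ∈ B) : C₀(X, ℂ) →CP B.topologicalClosure where
  toFun h := ⟨A.op h, op_C0_mem_topologicalClosure hB hA h⟩
  map_add' h k := Subtype.ext (A.op_add (isBddMeas_C0 h) (isBddMeas_C0 k))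
  map_smul' c h := Subtype.ext (A.op_const_mul c (isBddMeas_C0 h))
  map_cstarMatrix_nonneg' k M hM := by
    -- a positive matrix of functions is `N* N`, and its entrywise integral is the matrix `gram`
    obtain ⟨N, rfl⟩ := exists_eq_star_mul_self hM
    refine cstarMatrix_nonneg_of_map_coe B.topologicalClosure _ ?_
    have h := gram_nonneg A (F := fun x i j => N i j x) fun i j => isBddMeas_C0 (N i j)
    convert h using 1
    refine CStarMatrix.ext fun i j => ?_
    change A.op ⇑((star N * N) i j) = A.op _
    congr 1
    ext x
    rw [CStarMatrix.mul_apply]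
    exact map_sum (⟨⟨fun h : C₀(X, ℂ) => h x, rfl⟩, fun _ _ => rfl⟩ : C₀(X, ℂ) →+ ℂ) _ _

theorem coe_cpOp [T2Space X] (hB : IsHereditary B) (A : POVM X H)
    (hA : ∀ U ∈ precompactOpens X, A U ∈ B) (h : C₀(X, ℂ)) :
    (cpOp hB A hA h : H →L[ℂ] H) = A.op (ofC0 h) := rfl

omit [MeasurableSpace X] [BorelSpace X] in
theorem ofC0_mul (h k : C₀(X, ℂ)) : ofC0 (h * k) = ofC0 h * ofC0 k := rfl

theorem norm_cpOp_mul_sub [T2Space X] (hB : IsHereditary B) (A : POVM X H)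
    (hA : ∀ U ∈ precompactOpens X, A U ∈ B) (h k : C₀(X, ℂ)) :
    ‖cpOp hB A hA (h * k) - cpOp hB A hA h * cpOp hB A hA k‖ = ‖mulDefect A (ofC0 h) (ofC0 k)‖ := by
  rw [mulDefect, ← ofC0_mul, ← coe_cpOp hB A hA, ← coe_cpOp hB A hA, ← coe_cpOp hB A hA]
  rfl

theorem tendsto_mulDefect_comp (A : ASM X H (precompactOpens X)) {c : Planck → Planck}
    (hc : ∀ᶠ ħ in toZero, c ħ = ħ) {C : ℝ} (hC0 : 0 < C)
    (hC : ∀ ħ, ‖A.toPOVM (c ħ) Set.univ‖ ≤ C) {f g : lp (fun _ : X => ℂ) ∞} (hf : f ∈ B0 X)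
    (hg : g ∈ B0 X) :
    Tendsto (fun ħ => ‖mulDefect (A.toPOVM (c ħ)) f g‖) toZero (𝓝 0) := by
  refine tendsto_mulDefect (A := fun ħ => A.toPOVM (c ħ)) hC0 hC (fun U hU V hV => ?_) hf hg
  refine (A.asymp_proj U hU V hV).congr' ?_
  filter_upwards [hc] with ħ hħ
  simp only [hħ]

theorem exists_posAsymptoticMorphism [T2Space X] (hB : IsHereditary B) (A : LocalASM X B) :
    ∃ Q : PosAsymptoticMorphism (B0 X) (H →L[ℂ] H), MapsC0Into B Q ∧
      (∀ᶠ ħ in toZero, A.RepresentsAt Q ħ) ∧ (A.1.UniformlyBounded → ∀ ħ, A.RepresentsAt Q ħ) := by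
  obtain ⟨c, hcc, hc, hcA, C, hC0, hC⟩ := A.1.exists_truncation
  have hrep : ∀ ħ, c ħ = ħ → ∀ f : B0 X, (A.1.toPOVM ħ).IsIntegral
      (fun x => (f : lp (fun _ : X => ℂ) ∞) x) (posOp (A.1.toPOVM (c ħ)) f) := fun ħ hħ f => by
    rw [hħ]
    exact (A.1.toPOVM ħ).isIntegral_op (isBddMeas_of_mem_B0 f.2)
  refine ⟨⟨fun ħ => posOp (A.1.toPOVM (c ħ)), fun f => ?_, fun f g => ?_⟩, ?_, ?_, ?_⟩
  · exact continuous_op_B0 (A := fun ħ => A.1.toPOVM (c ħ)) hC0 hC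
      (fun U hU => (A.1.continuous_apply U hU).comp hcc) f.2
  · simp only [posOp_mul_sub]
    exact tendsto_mulDefect_comp A.1 hc hC0 hC f.2 g.2
  · intro f h hfh ħ
    have hA : ∀ U ∈ precompactOpens X, A.1.toPOVM (c ħ) U ∈ B := A.2 (c ħ)
    have e : posOp (A.1.toPOVM (c ħ)) f = (A.1.toPOVM (c ħ)).op h := by
      rw [posOp_apply, funext hfh]
    change posOp (A.1.toPOVM (c ħ)) f ∈ _ ∧ (_ → posOp (A.1.toPOVM (c ħ)) f ∈ _)
    rw [e]
    exact ⟨op_C0_mem_topologicalClosure hB hA h, op_mem_of_hasCompactSupport hB hA h⟩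
  · filter_upwards [hc] with ħ hħ using hrep ħ hħ
  · exact fun hA ħ => hrep ħ (hcA hA ħ)

theorem exists_cpAsymptoticMorphism [T2Space X] (hB : IsHereditary B) (A : LocalASM X B) :
    ∃ R : CPAsymptoticMorphism C₀(X, ℂ) B.topologicalClosure,
      (∀ᶠ ħ in toZero, A.RepresentsCPAt R ħ) ∧
      (A.1.UniformlyBounded → ∀ ħ, A.RepresentsCPAt R ħ) := by
  obtain ⟨c, hcc, hc, hcA, C, hC0, hC⟩ := A.1.exists_truncation
  have hrep : ∀ ħ, c ħ = ħ → ∀ h : C₀(X, ℂ), (A.1.toPOVM ħ).IsIntegral h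
      (cpOp hB (A.1.toPOVM (c ħ)) (A.2 (c ħ)) h : H →L[ℂ] H) := fun ħ hħ h => by
    rw [coe_cpOp, hħ]
    exact (A.1.toPOVM ħ).isIntegral_op (isBddMeas_C0 h)
  refine ⟨⟨fun ħ => cpOp hB (A.1.toPOVM (c ħ)) (A.2 (c ħ)), fun h => ?_, fun h k => ?_⟩, ?_, ?_⟩
  · exact (continuous_op_B0 (A := fun ħ => A.1.toPOVM (c ħ)) hC0 hC
      (fun U hU => (A.1.continuous_apply U hU).comp hcc) (ofC0_mem_B0 h)).subtype_mk _
  · simp only [norm_cpOp_mul_sub]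
    exact tendsto_mulDefect_comp A.1 hc hC0 hC (ofC0_mem_B0 h) (ofC0_mem_B0 k)
  · filter_upwards [hc] with ħ hħ using hrep ħ hħ
  · exact fun hA ħ => hrep ħ (hcA hA ħ)

theorem ASM.Equivalent.tendsto_op_sub {A A' : ASM X H (precompactOpens X)} (h : A.Equivalent A')
    {f : lp (fun _ : X => ℂ) ∞} (hf : f ∈ B0 X) :
    Tendsto (fun ħ => ‖(A.toPOVM ħ).op f - (A'.toPOVM ħ).op f‖) toZero (𝓝 0) := by
  obtain ⟨c, -, hc, -, C, hC0, hC⟩ := A.exists_truncation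
  obtain ⟨c', -, hc', -, C', -, hC'⟩ := A'.exists_truncation
  have := tendsto_op_sub_op (A := fun ħ => A.toPOVM (c ħ)) (A' := fun ħ => A'.toPOVM (c' ħ))
    (C := max C C') (lt_max_of_lt_left hC0) (fun ħ => (hC ħ).trans (le_max_left _ _))
    (fun ħ => (hC' ħ).trans (le_max_right _ _)) (fun U hU => (h U hU).congr' ?_) hf
  · refine this.congr' ?_
    filter_upwards [hc, hc'] with ħ hħ hħ'
    simp only [hħ, hħ']
  · filter_upwards [hc, hc'] with ħ hħ hħ'
    simp only [hħ, hħ']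

theorem equivalent_iff_equivalent (A A' : LocalASM X B)
    (Q Q' : PosAsymptoticMorphism (B0 X) (H →L[ℂ] H)) (hQ : ∀ᶠ ħ in toZero, A.RepresentsAt Q ħ)
    (hQ' : ∀ᶠ ħ in toZero, A'.RepresentsAt Q' ħ) : A.1.Equivalent A'.1 ↔ Q.Equivalent Q' := by
  have key : ∀ f : B0 X,
      (fun ħ => ‖(A.1.toPOVM ħ).op (f : lp (fun _ : X => ℂ) ∞) - (A'.1.toPOVM ħ).op f‖)
        =ᶠ[toZero] fun ħ => ‖Q.toMap ħ f - Q'.toMap ħ f‖ := fun f => by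
    filter_upwards [hQ, hQ'] with ħ h h'
    rw [(h f).op_eq, (h' f).op_eq]
  refine ⟨fun h f => (h.tendsto_op_sub f.2).congr' (key f), fun h U hU => ?_⟩
  have := (h ⟨chi U, chi_mem_B0 hU⟩).congr' (key _).symm
  simpa only [op_chi _ hU] using this

/-- Any two completely positive asymptotic morphisms that represent equivalent asymptotic spectral
measures are equivalent. -/
theorem cpEquivalent_of_equivalent [T2Space X] {A A' : LocalASM X B} (h : A.1.Equivalent A'.1)
    {R R' : CPAsymptoticMorphism C₀(X, ℂ) B.topologicalClosure}
    (hR : ∀ᶠ ħ in toZero, A.RepresentsCPAt R ħ) (hR' : ∀ᶠ ħ in toZero, A'.RepresentsCPAt R' ħ) :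
    R.Equivalent R' := fun k => by
  refine (h.tendsto_op_sub (ofC0_mem_B0 k)).congr' ?_
  filter_upwards [hR, hR'] with ħ h h'
  rw [coe_ofC0, (h k).op_eq, (h' k).op_eq]
  rfl

theorem existsUnique_classMap [T2Space X] (hB : IsHereditary B) :
    ∃! Φ : ASMClasses X B → CPClasses C₀(X, ℂ) B.topologicalClosure,
      ∀ (A : LocalASM X B) (R : CPAsymptoticMorphism C₀(X, ℂ) B.topologicalClosure),
        (∀ᶠ ħ in toZero, A.RepresentsCPAt R ħ) → Φ A.cls = R.cls := by
  choose R hR _ using fun A : LocalASM X B => exists_cpAsymptoticMorphism hB A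
  refine ⟨Quotient.lift (fun A => (R A).cls) fun A A' h => Quotient.sound
    (cpEquivalent_of_equivalent h (hR A) (hR A')), fun A S hS => Quotient.sound
    (cpEquivalent_of_equivalent ((LocalASM.setoid X B).refl A) (hR A) hS), fun Ψ hΨ => ?_⟩
  funext a
  induction a using Quotient.inductionOn with
  | h A => exact hΨ A (R A) (hR A)

end Morphisms

end AsymSpec

theorem corollary4p3
    (X : Type*) [TopologicalSpace X] [T2Space X] [LocallyCompactSpace X] [SigmaCompactSpace X]
    [MeasurableSpace X] [BorelSpace X]
    (H : Type*) [NormedAddCommGroup H] [InnerProductSpace ℂ H] [CompleteSpace H]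
    (B : NonUnitalStarSubalgebra ℂ (H →L[ℂ] H)) (hB : AsymSpec.IsHereditary B) :
    -- `C_0(X)` is contained in `B_0(X)`
    (∀ h : C₀(X, ℂ), ∃ f : AsymSpec.B0 X, ∀ x, (f : lp (fun _ : X => ℂ) ∞) x = h x) ∧
    -- every asymptotic spectral measure has a corresponding positive asymptotic morphism
    (∀ A : AsymSpec.LocalASM X B,
      ∃ Q : AsymSpec.PosAsymptoticMorphism (AsymSpec.B0 X) (H →L[ℂ] H),
        AsymSpec.MapsC0Into B Q ∧
        (∀ᶠ ħ in AsymSpec.toZero, A.RepresentsAt Q ħ) ∧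
        (A.1.UniformlyBounded → ∀ ħ, A.RepresentsAt Q ħ)) ∧
    -- equivalent asymptotic spectral measures correspond to equivalent asymptotic morphisms
    (∀ (A A' : AsymSpec.LocalASM X B)
      (Q Q' : AsymSpec.PosAsymptoticMorphism (AsymSpec.B0 X) (H →L[ℂ] H)),
      (∀ᶠ ħ in AsymSpec.toZero, A.RepresentsAt Q ħ) →
      (∀ᶠ ħ in AsymSpec.toZero, A'.RepresentsAt Q' ħ) →
      (A.1.Equivalent A'.1 ↔ Q.Equivalent Q')) ∧
    -- every asymptotic spectral measure gives a completely positive asymptotic morphism on `C_0(X)`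
    (∀ A : AsymSpec.LocalASM X B,
      ∃ R : AsymSpec.CPAsymptoticMorphism C₀(X, ℂ) B.topologicalClosure,
        (∀ᶠ ħ in AsymSpec.toZero, A.RepresentsCPAt R ħ) ∧
        (A.1.UniformlyBounded → ∀ ħ, A.RepresentsCPAt R ħ)) ∧
    -- the class of the latter depends only on the class of the former
    (∃! Φ : AsymSpec.ASMClasses X B →
        AsymSpec.CPClasses C₀(X, ℂ) B.topologicalClosure,
      ∀ (A : AsymSpec.LocalASM X B)
        (R : AsymSpec.CPAsymptoticMorphism C₀(X, ℂ) B.topologicalClosure),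
        (∀ᶠ ħ in AsymSpec.toZero, A.RepresentsCPAt R ħ) → Φ A.cls = R.cls) :=
  ⟨fun h => ⟨⟨AsymSpec.ofC0 h, AsymSpec.ofC0_mem_B0 h⟩, fun _ => rfl⟩,
    AsymSpec.exists_posAsymptoticMorphism hB, AsymSpec.equivalent_iff_equivalent,
    AsymSpec.exists_cpAsymptoticMorphism hB, AsymSpec.existsUnique_classMap hB⟩
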